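/- Let $d\ge 1$ and let $\rho:\mathbb R^d\to(0,\infty)$ be a critical radius function, that is, there are constants $C_0,N_0\ge 1$ such that for all $x,y\in\mathbb R^d$ $$C_0^{-1}\rho(x)\Big(1+\frac{|x-y|}{\rho(x)}\Big)^{-N_0}\le \rho(y)\le C_0\,\rho(x)\Big(1+\frac{|x-y|}{\rho(x)}\Big)^{\frac{N_0}{N_0+1}}.$$ For $x\in\mathbb R^d$ and $r>0$ let $Q(x,r)$ be the cube with sides parallel to the coordinate axes, center $x$ and radius $r$, meaning that its side length $\ell$ satisfies $r=\sqrt d\,\ell/2$. A weight is a locally integrable function $w$ on $\mathbb R^d$ with $0<w<\infty$ almost everywhere, and $w(E)=\int_E w$. For a weight $u$ and $\theta\ge0$, a weight $w$ belongs to $A_1^{\rho,\theta}(u)$ if there is a constant $C$ such that for every cube $Q=Q(x,r)$ $$\frac1{u(Q)}\int_Q wu\le C\Big(1+\frac r{\rho(x)}\Big)^{\theta}\operatorname*{ess\,inf}_Q w,$$ and, for $1<p<\infty$ and $p'=p/(p-1)$, it belongs to $A_p^{\rho,\theta}(u)$ if there is a constant $C$ such that for every cube $Q=Q(x,r)$ $$\Big(\frac1{u(Q)}\int_Q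 wu\Big)^{1/p}\Big(\frac1{u(Q)}\int_Q w^{1-p'}u\Big)^{1/p'}\le C\Big(1+\frac r{\rho(x)}\Big)^{\theta}.$$ Put $A_p^\rho(u)=\bigcup_{\theta\ge0}A_p^{\rho,\theta}(u)$ for $1\le p<\infty$, $A_\infty^\rho(u)=\bigcup_{1\le p<\infty}A_p^\rho(u)$, and $A_1^\rho=A_1^\rho(1)$. For $\sigma\ge0$ let $$M^{\rho,\sigma}g(x)=\sup_{Q(x_0,r_0)\ni x}\Big(1+\frac{r_0}{\rho(x_0)}\Big)^{-\sigma}\frac1{|Q(x_0,r_0)|}\int_{Q(x_0,r_0)}|g(y)|\,dy.$$ Let $u\in A_1^\rho$ and $v\in A_\infty^\rho(u)$. Then there exist $\sigma\ge0$ and a constant $C$ such that $$uv\Big(\Big\{x\in\mathbb R^d:\frac{M^{\rho,\sigma}(fv)(x)}{v(x)}>t\Big\}\Big)\le\frac Ct\int_{\mathbb R^d}|f(x)|\,u(x)v(x)\,dx$$ for every $t>0$ and every bounded measurable function $f:\mathbb R^d\to\mathbb R$ with compact support, where $uv(E)=\int_E uv$. -/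

import Mathlib

open MeasureTheory
open scoped ENNReal NNReal

noncomputable section

namespace CriticalRadius

/-- `ρ : ℝ^d → (0, ∞)` is a critical radius function. -/
def IsCriticalRadius {d : ℕ} (ρ : EuclideanSpace ℝ (Fin d) → ℝ) : Prop :=
  (∀ x, 0 < ρ x) ∧
  ∃ C₀ N₀ : ℝ, 1 ≤ C₀ ∧ 1 ≤ N₀ ∧ ∀ x y,
    C₀⁻¹ * ρ x * (1 + ‖x - y‖ / ρ x) ^ (-N₀) ≤ ρ y ∧
    ρ y ≤ C₀ * ρ x * (1 + ‖x - y‖ / ρ x) ^ (N₀ / (N₀ + 1))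

/-- The cube `Q(x, r)` with sides parallel to the axes, center `x` and radius `r = √d ℓ(Q) / 2`,
so that its half side length is `r / √d`. -/
def cube {d : ℕ} (x : EuclideanSpace ℝ (Fin d)) (r : ℝ) : Set (EuclideanSpace ℝ (Fin d)) :=
  {y | ∀ i, |y i - x i| ≤ r / √(d : ℝ)}

/-- A weight: a locally integrable function that is positive and finite almost everywhere. -/
def IsWeight {d : ℕ} (w : EuclideanSpace ℝ (Fin d) → ℝ≥0∞) : Prop :=
  LocallyIntegrable w volume ∧ ∀ᵐ x, 0 < w x ∧ w x < ∞

/-- The average `(1 / u(Q)) ∫_Q g u`, with `u(Q) = ∫_Q u`. -/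
def wAverage {d : ℕ} (u g : EuclideanSpace ℝ (Fin d) → ℝ≥0∞)
    (Q : Set (EuclideanSpace ℝ (Fin d))) : ℝ≥0∞ :=
  (∫⁻ y in Q, g y * u y) / ∫⁻ y in Q, u y

/-- The class `A_1^{ρ,θ}(u)`; the infimum over `Q` is the essential infimum. -/
def A1Theta {d : ℕ} (ρ : EuclideanSpace ℝ (Fin d) → ℝ) (θ : ℝ)
    (u : EuclideanSpace ℝ (Fin d) → ℝ≥0∞) : Set (EuclideanSpace ℝ (Fin d) → ℝ≥0∞) :=
  {w | IsWeight w ∧ ∃ C : ℝ≥0, ∀ (x : EuclideanSpace ℝ (Fin d)) (r : ℝ), 0 < r →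
    wAverage u w (cube x r) ≤
      C * ENNReal.ofReal ((1 + r / ρ x) ^ θ) * essInf w (volume.restrict (cube x r))}

/-- The class `A_p^{ρ,θ}(u)` for `1 < p < ∞`; here `p' = p.conjExponent = p / (p - 1)`. -/
def ApTheta {d : ℕ} (ρ : EuclideanSpace ℝ (Fin d) → ℝ) (p θ : ℝ)
    (u : EuclideanSpace ℝ (Fin d) → ℝ≥0∞) : Set (EuclideanSpace ℝ (Fin d) → ℝ≥0∞) :=
  {w | IsWeight w ∧ ∃ C : ℝ≥0, ∀ (x : EuclideanSpace ℝ (Fin d)) (r : ℝ), 0 < r →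
    wAverage u w (cube x r) ^ (1 / p) *
        wAverage u (fun y => w y ^ (1 - p.conjExponent)) (cube x r) ^ (1 / p.conjExponent) ≤
      C * ENNReal.ofReal ((1 + r / ρ x) ^ θ)}

/-- The class `A_1^ρ(u)`, the union over `θ ≥ 0` of the classes `A_1^{ρ,θ}(u)`. -/
def A1 {d : ℕ} (ρ : EuclideanSpace ℝ (Fin d) → ℝ)
    (u : EuclideanSpace ℝ (Fin d) → ℝ≥0∞) : Set (EuclideanSpace ℝ (Fin d) → ℝ≥0∞) :=
  {w | ∃ θ : ℝ, 0 ≤ θ ∧ w ∈ A1Theta ρ θ u}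

/-- The class `A_p^ρ(u)` for `1 < p < ∞`, the union over `θ ≥ 0` of the `A_p^{ρ,θ}(u)`. -/
def Ap {d : ℕ} (ρ : EuclideanSpace ℝ (Fin d) → ℝ) (p : ℝ)
    (u : EuclideanSpace ℝ (Fin d) → ℝ≥0∞) : Set (EuclideanSpace ℝ (Fin d) → ℝ≥0∞) :=
  {w | ∃ θ : ℝ, 0 ≤ θ ∧ w ∈ ApTheta ρ p θ u}

/-- The class `A_∞^ρ(u)`, the union over `1 ≤ p < ∞` of the classes `A_p^ρ(u)`. -/
def AInfty {d : ℕ} (ρ : EuclideanSpace ℝ (Fin d) → ℝ)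
    (u : EuclideanSpace ℝ (Fin d) → ℝ≥0∞) : Set (EuclideanSpace ℝ (Fin d) → ℝ≥0∞) :=
  {w | w ∈ A1 ρ u ∨ ∃ p : ℝ, 1 < p ∧ w ∈ Ap ρ p u}

/-- The maximal operator `M^{ρ,σ}` applied to `g` (which enters only through `|g|`), at `x`:
the supremum over all cubes `Q(x₀, r₀)`, `r₀ > 0`, that contain `x`. -/
def maximal {d : ℕ} {ε : Type*} [ENorm ε] (ρ : EuclideanSpace ℝ (Fin d) → ℝ) (σ : ℝ)
    (g : EuclideanSpace ℝ (Fin d) → ε) (x : EuclideanSpace ℝ (Fin d)) : ℝ≥0∞ :=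
  ⨆ (x₀ : EuclideanSpace ℝ (Fin d)) (r₀ : ℝ) (_ : 0 < r₀) (_ : x ∈ cube x₀ r₀),
    ENNReal.ofReal ((1 + r₀ / ρ x₀) ^ (-σ)) *
      ((∫⁻ y in cube x₀ r₀, ‖g y‖ₑ) / volume (cube x₀ r₀))

end CriticalRadius

end

/-! Put `μ = u dx` and `g = |f| v`, so that `∫ |f| u v = ∫ g dμ`. The `A_1` condition on `u` turns
Lebesgue averages into `μ`-averages at the price of a power of the growth factor `1 + r / ρ`, and
the one-third trick encloses each cube in a comparable cell of one of `2 ^ d` shifted dyadic grids.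
For large `σ` the discount pays for both and still leaves the growth factor of the cell to the power
`-(N + 1)` (`exists_discounted_average_le`). For each grid it remains to bound the `uv`-measure of
the points `x` lying in a cell `Q` with `v x` below a multiple of the discounted `μ`-average of `g`
over `Q`. Two regimes are treated differently.

Cells of radius at most `ρ` have growth factor at most 2, so `v` satisfies an `A_p` condition
relative to `μ` on them with one constant, and only the nesting of the cells matters
(`exists_withDensity_lt_average_le`). If the average of `v` over `Q` is at most that of `g`, then
`∫_Q v dμ ≤ ∫_Q g dμ`, and maximal such cells are disjoint. Otherwise the ratio of the averages is
about `2 ^ i`, and `x` lies where `v` is below `2 ^ (-i)` times its average. By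
`exists_withDensity_lt_mul_average_le` that set has at most a multiple of `2 ^ (-i(1 + s))` of the
`v dμ`-measure of the union of these cells, itself at most `2 ^ (i + 1) ∫ g dμ`. The bounds sum like
`2 ^ (-i s)`.

Cells larger than `ρ` need no `A_p` condition: the trivial bound on each cell suffices, because the
discounts of all such cells through a given point have a bounded sum
(`exists_tsum_supercritical_le`). -/

noncomputable section

namespace CriticalRadius

/-! ### Geometric sums over dyadic scales -/

/-- The sum of the powers `(2 ^ k) ^ s`, `k ∈ ℤ`, below a threshold is controlled by its
largest term. -/
lemma exists_tsum_zpow_rpow_le {s : ℝ} (hs : 0 < s) : ∃ C : ℝ≥0, 0 < C ∧ ∀ b : ℝ≥0∞,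
    ∑' k : ℤ, (if (2 : ℝ≥0∞) ^ k ≤ b then ((2 : ℝ≥0∞) ^ k) ^ s else 0) ≤ C * b ^ s := by
  set q : ℝ≥0∞ := (2 : ℝ≥0∞) ^ (-s) with hq
  have hq1 : q < 1 := ENNReal.rpow_lt_one_of_one_lt_of_neg (by norm_num) (by linarith)
  have hfin : (1 - q)⁻¹ ≠ ∞ := ENNReal.inv_ne_top.2 (tsub_pos_of_lt hq1).ne'
  have hpos : (1 - q)⁻¹ ≠ 0 := ENNReal.inv_ne_zero.2 (ENNReal.sub_ne_top (by norm_num))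
  refine ⟨((1 - q)⁻¹).toNNReal, ENNReal.toNNReal_pos hpos hfin, fun b => ?_⟩
  rw [ENNReal.coe_toNNReal hfin]
  rcases eq_or_ne b 0 with rfl | hb0
  · simp [hs, (ENNReal.zpow_pos (two_ne_zero) ENNReal.ofNat_ne_top _).ne']
  rcases eq_or_ne b ∞ with rfl | hbt
  · rw [ENNReal.top_rpow_of_pos hs, ENNReal.mul_top hpos]; exact le_top
  obtain ⟨n, hn1, hn2⟩ := ENNReal.exists_mem_Ico_zpow hb0 hbt (by norm_num : (1 : ℝ≥0∞) < 2)
    ENNReal.ofNat_ne_top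
  -- With `2 ^ n ≤ b < 2 ^ (n + 1)`, counting downwards from `n` leaves only indices `k ≥ 0` and a
  -- geometric series of ratio `q`.
  rw [← (Equiv.subLeft n).tsum_eq]
  let G : ℤ → ℝ≥0∞ := fun k => if 0 ≤ k then b ^ s * q ^ k.toNat else 0
  have hFG : ∀ k : ℤ, (if (2 : ℝ≥0∞) ^ (Equiv.subLeft n k) ≤ b then
      ((2 : ℝ≥0∞) ^ (Equiv.subLeft n k)) ^ s else 0) ≤ G k := by
    intro k
    simp only [Equiv.subLeft_apply, G]
    split_ifs with h1 h2 h2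
    · obtain ⟨j, rfl⟩ := Int.eq_ofNat_of_zero_le h2
      have : (2 : ℝ≥0∞) ^ (n - (j : ℤ)) = 2 ^ n * (2 ^ j)⁻¹ := by
        rw [sub_eq_add_neg, ENNReal.zpow_add two_ne_zero ENNReal.ofNat_ne_top,
          ENNReal.zpow_neg, zpow_natCast]
      rw [this, ENNReal.mul_rpow_of_nonneg _ _ hs.le]
      refine mul_le_mul' (ENNReal.rpow_le_rpow hn1 hs.le) (le_of_eq ?_)
      rw [hq, ENNReal.rpow_neg, ENNReal.inv_rpow]
      simp only [Int.toNat_natCast]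
      rw [← ENNReal.inv_pow]
      congr 1
      rw [← ENNReal.rpow_natCast, ← ENNReal.rpow_natCast, ← ENNReal.rpow_mul,
        ← ENNReal.rpow_mul, mul_comm]
    · exfalso
      have : (2 : ℝ≥0∞) ^ (n + 1) ≤ 2 ^ (n - k) :=
        ENNReal.zpow_le_of_le (by norm_num) (by omega)
      exact absurd (this.trans h1) (not_le.2 hn2)
    · exact zero_le
    · exact le_rfl
  refine (ENNReal.tsum_le_tsum hFG).trans (le_of_eq ?_)
  rw [← (Nat.cast_injective (R := ℤ)).tsum_eq (f := G)]
  · simp only [G, Nat.cast_nonneg, if_true, Int.toNat_natCast]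
    rw [ENNReal.tsum_mul_left, ENNReal.tsum_geometric, mul_comm]
  · intro k hk
    simp only [G, Function.mem_support, ne_eq, ite_eq_right_iff, not_forall] at hk
    obtain ⟨h, -⟩ := hk
    exact ⟨k.toNat, by simp [h]⟩

/-! ### Laminar families and their maximal functions -/

/-- A family of sets is laminar if any two of its members are nested or disjoint. -/
def IsLaminar {X : Type*} (F : Set (Set X)) : Prop :=
  ∀ P ∈ F, ∀ Q ∈ F, Disjoint P Q ∨ P ⊆ Q ∨ Q ⊆ P

lemma IsLaminar.mono {X : Type*} {F G : Set (Set X)} (hG : IsLaminar G) (h : F ⊆ G) : IsLaminar F :=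
  fun P hP Q hQ => hG P (h hP) Q (h hQ)

/-- The maximal members are disjoint by laminarity, and by finiteness every member lies in one. This
replaces a covering lemma, so no doubling is needed. -/
lemma IsLaminar.exists_pairwiseDisjoint {X : Type*} {F : Finset (Set X)} (hF : IsLaminar (F : Set (Set X))) :
    ∃ G ⊆ F, (G : Set (Set X)).PairwiseDisjoint id ∧ ⋃ Q ∈ F, Q = ⋃ Q ∈ G, Q := by
  classical
  refine ⟨F.filter (fun Q => Maximal (· ∈ F) Q), Finset.filter_subset _ _, ?_, ?_⟩
  · intro P hP Q hQ hPQ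
    simp only [Finset.coe_filter, Set.mem_ofPred_eq] at hP hQ
    rcases hF P hP.1 Q hQ.1 with h | h | h
    · exact h
    · exact absurd (hP.2.eq_of_le hQ.1 h) hPQ
    · exact absurd (hQ.2.eq_of_le hP.1 h).symm hPQ
  · refine Set.Subset.antisymm ?_ ?_
    · refine Set.iUnion₂_subset fun Q hQ => ?_
      obtain ⟨P, hQP, hP⟩ := F.exists_le_maximal hQ
      exact hQP.trans (Set.subset_biUnion_of_mem (u := fun x : Set X => x) (by simpa using ⟨hP.1, hP⟩))
    · exact Set.biUnion_subset_biUnion_left fun Q hQ => (Finset.mem_filter.1 hQ).1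

lemma IsLaminar.measure_biUnion_le {X : Type*} [MeasurableSpace X] 
    {F : Finset (Set X)} (hF : IsLaminar (F : Set (Set X)))
    (hm : ∀ Q ∈ F, MeasurableSet Q) {μ ν : Measure X} {φ : X → ℝ≥0∞} {c : ℝ≥0∞}
    (h : ∀ Q ∈ F, c * ν Q ≤ ∫⁻ x in Q, φ x ∂μ) :
    c * ν (⋃ Q ∈ F, Q) ≤ ∫⁻ x in ⋃ Q ∈ F, Q, φ x ∂μ := by
  obtain ⟨G, hGF, hd, hU⟩ := hF.exists_pairwiseDisjoint
  rw [hU, lintegral_biUnion_finset (t := fun Q : Set X => Q) hd fun Q hQ => hm Q (hGF hQ)]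
  refine (mul_le_mul_right (measure_biUnion_finset_le G _) _).trans ?_
  rw [Finset.mul_sum]
  exact Finset.sum_le_sum fun Q hQ => h Q (hGF hQ)

/-- The maximal function of `h` with respect to `ν` over a finite family of sets. -/
def familyMaximal {X : Type*} [MeasurableSpace X] (ν : Measure X) (F : Finset (Set X)) (h : X → ℝ≥0∞) (x : X) : ℝ≥0∞ :=
  F.sup fun Q => Q.indicator (fun _ => (∫⁻ y in Q, h y ∂ν) / ν Q) x

lemma measurable_familyMaximal {X : Type*} [MeasurableSpace X] 
    (ν : Measure X) {F : Finset (Set X)} (h : X → ℝ≥0∞)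
    (hm : ∀ Q ∈ F, MeasurableSet Q) : Measurable (familyMaximal ν F h) := by
  unfold familyMaximal
  simp only [Finset.sup_eq_iSup]
  exact Measurable.biSup _ F.countable_toSet fun Q hQ => measurable_const.indicator (hm Q hQ)

lemma lt_familyMaximal_iff {X : Type*} [MeasurableSpace X] 
    {ν : Measure X} {F : Finset (Set X)} {h : X → ℝ≥0∞} {x : X}
    {t : ℝ≥0∞} : t < familyMaximal ν F h x ↔
      ∃ Q ∈ F, x ∈ Q ∧ t < (∫⁻ y in Q, h y ∂ν) / ν Q := by
  simp only [familyMaximal, Finset.lt_sup_iff]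
  refine exists_congr fun Q => and_congr_right fun _ => ?_
  by_cases hx : x ∈ Q <;> simp [hx]

lemma le_familyMaximal {X : Type*} [MeasurableSpace X] 
    {ν : Measure X} {F : Finset (Set X)} {h : X → ℝ≥0∞} {x : X}
    {Q : Set X} (hQ : Q ∈ F) (hx : x ∈ Q) :
    (∫⁻ y in Q, h y ∂ν) / ν Q ≤ familyMaximal ν F h x := by
  refine le_trans ?_ (Finset.le_sup (f := fun Q => Q.indicator
    (fun _ => (∫⁻ y in Q, h y ∂ν) / ν Q) x) hQ)
  simp [hx]

/-- On a set `Q` whose average exceeds `2 * t`, the part of `h` below `t` contributes at most `t * ν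
Q`, so the part above `t` contributes at least as much. The maximal sets of this kind are disjoint.
Keeping only `{t < h}` on the right is what allows integration in `t`. -/
lemma IsLaminar.mul_measure_lt_familyMaximal_le {X : Type*} [MeasurableSpace X] 
    {F : Finset (Set X)}
    (hF : IsLaminar (F : Set (Set X))) (hm : ∀ Q ∈ F, MeasurableSet Q) {ν : Measure X}
    (hν : ∀ Q ∈ F, ν Q ≠ ∞) {h : X → ℝ≥0∞} (hh : Measurable h) {t : ℝ≥0∞} (ht : t ≠ ∞) :
    t * ν {x | 2 * t < familyMaximal ν F h x} ≤ ∫⁻ x in {x | t < h x}, h x ∂ν := by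
  classical
  set G := F.filter fun Q => 2 * t < (∫⁻ y in Q, h y ∂ν) / ν Q with hG
  have hGF : G ⊆ F := Finset.filter_subset _ _
  have hset : {x | 2 * t < familyMaximal ν F h x} = ⋃ Q ∈ G, Q := by
    ext x
    simp only [Set.mem_ofPred_eq, lt_familyMaximal_iff, hG, Finset.mem_filter, Set.mem_iUnion,
      exists_prop]
    exact exists_congr fun Q => by tauto
  have hmt : MeasurableSet {x | t < h x} := measurableSet_lt measurable_const hh
  rw [hset, ← lintegral_indicator hmt]
  refine le_trans ((hF.mono (by exact_mod_cast hGF)).measure_biUnion_le (fun Q hQ => hm Q (hGF hQ))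
    (μ := ν) (φ := {x | t < h x}.indicator h) fun Q hQ => ?_) (setLIntegral_le_lintegral _ _)
  have hQ2 : 2 * t * ν Q ≤ ∫⁻ y in Q, h y ∂ν :=
    ENNReal.mul_le_of_le_div (Finset.mem_filter.1 hQ).2.le
  have hsplit : ∫⁻ y in Q, h y ∂ν ≤ (∫⁻ y in Q, {x | t < h x}.indicator h y ∂ν) + t * ν Q := by
    rw [← setLIntegral_const, ← lintegral_add_right _ measurable_const]
    refine lintegral_mono fun y => ?_
    by_cases hy : t < h y
    · simp [hy]
    · simpa [hy] using not_lt.1 hy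
  have hfin : t * ν Q ≠ ∞ := ENNReal.mul_ne_top ht (hν Q (hGF hQ))
  refine (ENNReal.add_le_add_iff_right hfin).1 (le_trans (le_of_eq ?_) (hQ2.trans hsplit))
  ring

/-- Strong type bound for the maximal function over a laminar family (Doob's inequality). -/
lemma exists_lintegral_familyMaximal_rpow_le {p : ℝ} (hp : 1 < p) : ∃ C : ℝ≥0,
    ∀ {X : Type*} [MeasurableSpace X] (F : Finset (Set X)), IsLaminar (F : Set (Set X)) →
      (∀ Q ∈ F, MeasurableSet Q) → ∀ ν : Measure X, (∀ Q ∈ F, ν Q ≠ ∞) →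
      ∀ h : X → ℝ≥0∞, Measurable h → (∀ x, familyMaximal ν F h x ≠ ∞) →
        ∫⁻ x, familyMaximal ν F h x ^ p ∂ν ≤ C * ∫⁻ x, h x ^ p ∂ν := by
  obtain ⟨C, -, hC⟩ := exists_tsum_zpow_rpow_le (s := p - 1) (by linarith)
  have h2 : (2 : ℝ≥0∞) ≠ 0 := two_ne_zero
  have h2t : (2 : ℝ≥0∞) ≠ ∞ := ENNReal.ofNat_ne_top
  refine ⟨(4 : ℝ≥0) ^ p * C, fun {X} _ F hF hm ν hν h hh hfin => ?_⟩
  have hz0 : ∀ k : ℤ, (2 : ℝ≥0∞) ^ k ≠ 0 := fun k => (ENNReal.zpow_pos h2 h2t k).ne'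
  have hzt : ∀ k : ℤ, (2 : ℝ≥0∞) ^ k ≠ ∞ := fun k => ENNReal.zpow_ne_top h2 h2t k
  have hlevel : ∀ k : ℤ, MeasurableSet {x | 2 * (2 : ℝ≥0∞) ^ k < familyMaximal ν F h x} :=
    fun k => measurableSet_lt measurable_const (measurable_familyMaximal ν h hm)
  have hpt : ∀ x, familyMaximal ν F h x ^ p ≤ ∑' k : ℤ,
      {x | 2 * (2 : ℝ≥0∞) ^ k < familyMaximal ν F h x}.indicator
        (fun _ => (4 * (2 : ℝ≥0∞) ^ k) ^ p) x := by
    intro x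
    rcases eq_or_ne (familyMaximal ν F h x) 0 with h0 | h0
    · rw [h0, ENNReal.zero_rpow_of_pos (by linarith)]; exact zero_le
    obtain ⟨n, hn1, hn2⟩ := ENNReal.exists_mem_Ioc_zpow h0 (hfin x)
      (by norm_num : (1 : ℝ≥0∞) < 2) h2t
    -- Values in `(2 ^ n, 2 ^ (n + 1)]` are caught by the index `n - 1`, since layer `k` has
    -- threshold `2 * 2 ^ k` and height `4 * 2 ^ k`.
    refine le_trans ?_ (ENNReal.le_tsum (n - 1))
    have e1 : 2 * (2 : ℝ≥0∞) ^ (n - 1) = 2 ^ n := by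
      conv_rhs => rw [show n = 1 + (n - 1) by ring, ENNReal.zpow_add h2 h2t]
      simp
    have e2 : 4 * (2 : ℝ≥0∞) ^ (n - 1) = 2 ^ (n + 1) := by
      rw [ENNReal.zpow_add h2 h2t, ← e1, zpow_one]; ring
    rw [Set.indicator_of_mem (by simpa [e1] using hn1), e2]
    exact ENNReal.rpow_le_rpow hn2 (by linarith)
  have hlev2 : ∀ k : ℤ, MeasurableSet {x | (2 : ℝ≥0∞) ^ k < h x} :=
    fun k => measurableSet_lt measurable_const hh
  calc ∫⁻ x, familyMaximal ν F h x ^ p ∂ν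
      ≤ ∑' k : ℤ, (4 * (2 : ℝ≥0∞) ^ k) ^ p *
          ν {x | 2 * (2 : ℝ≥0∞) ^ k < familyMaximal ν F h x} := by
        refine (lintegral_mono hpt).trans (le_of_eq ?_)
        rw [lintegral_tsum fun k => (measurable_const.indicator (hlevel k)).aemeasurable]
        exact tsum_congr fun k => lintegral_indicator_const (hlevel k) _
    _ ≤ ∑' k : ℤ, ∫⁻ x, 4 ^ p * (h x *
          (if (2 : ℝ≥0∞) ^ k ≤ h x then ((2 : ℝ≥0∞) ^ k) ^ (p - 1) else 0)) ∂ν := by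
        refine ENNReal.tsum_le_tsum fun k => ?_
        -- One factor `2 ^ k` is split off for the weak type bound; the remaining powers of exponent
        -- `p - 1` are summed over the levels below `h x`.
        have e : (4 * (2 : ℝ≥0∞) ^ k) ^ p =
            4 ^ p * ((2 : ℝ≥0∞) ^ k) ^ (p - 1) * (2 : ℝ≥0∞) ^ k := by
          rw [ENNReal.mul_rpow_of_nonneg _ _ (by linarith), mul_assoc]
          congr 1
          conv_lhs => rw [show p = (p - 1) + 1 by ring]
          rw [ENNReal.rpow_add _ _ (hz0 k) (hzt k), ENNReal.rpow_one]
        rw [e, mul_assoc]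
        refine (mul_le_mul_right (hF.mul_measure_lt_familyMaximal_le hm hν hh (hzt k)) _).trans ?_
        rw [← lintegral_indicator (hlev2 k), ← lintegral_const_mul _ (hh.indicator (hlev2 k))]
        refine lintegral_mono fun x => ?_
        by_cases hx : (2 : ℝ≥0∞) ^ k < h x
        · simp only [Set.indicator_of_mem (show x ∈ {x | (2 : ℝ≥0∞) ^ k < h x} from hx),
            if_pos hx.le]
          exact le_of_eq (by ring)
        · simp [hx]
    _ = ∫⁻ x, 4 ^ p * (h x * ∑' k : ℤ,
          (if (2 : ℝ≥0∞) ^ k ≤ h x then ((2 : ℝ≥0∞) ^ k) ^ (p - 1) else 0)) ∂ν := by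
        rw [← lintegral_tsum]
        · simp_rw [ENNReal.tsum_mul_left]
        · intro k
          refine Measurable.aemeasurable (measurable_const.mul (hh.mul ?_))
          exact Measurable.ite (measurableSet_le measurable_const hh) measurable_const
            measurable_const
    _ ≤ ∫⁻ x, ((4 : ℝ≥0) ^ p * C : ℝ≥0) * h x ^ p ∂ν := by
        refine lintegral_mono fun x => ?_
        rcases eq_or_ne (h x) 0 with h0 | h0
        · simp [h0]
        refine (mul_le_mul_right (mul_le_mul_right (hC (h x)) _) _).trans (le_of_eq ?_)
        have : h x * h x ^ (p - 1) = h x ^ p := by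
          rcases eq_or_ne (h x) ∞ with ht | ht
          · rw [ht, ENNReal.top_rpow_of_pos (by linarith), ENNReal.top_rpow_of_pos (by linarith)]
            simp
          · conv_rhs => rw [show p = 1 + (p - 1) by ring, ENNReal.rpow_add _ _ h0 ht,
              ENNReal.rpow_one]
        rw [← this, ENNReal.coe_mul, ENNReal.coe_rpow_of_nonneg _ (by linarith)]
        simp only [ENNReal.coe_ofNat]
        ring
    _ = _ := lintegral_const_mul' _ _ ENNReal.coe_ne_top

/-! ### Mixed weak type inequalities over laminar families -/

/-- In a family satisfying an `A_p` condition, the weighted measure of the set where `v` is much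
smaller than its maximal function decays faster than linearly. -/
lemma exists_withDensity_lt_mul_average_le {s : ℝ} (hs : 0 < s) (K : ℝ≥0) : ∃ C : ℝ≥0,
    ∀ {X : Type*} [MeasurableSpace X] (μ : Measure X) (v : X → ℝ≥0∞), Measurable v →
      (∀ x, v x ≠ 0) → (∀ x, v x ≠ ∞) → ∀ F : Finset (Set X), IsLaminar (F : Set (Set X)) →
      (∀ Q ∈ F, MeasurableSet Q) → (∀ Q ∈ F, μ Q ≠ 0) → (∀ Q ∈ F, μ Q ≠ ∞) →
      (∀ Q ∈ F, ((∫⁻ y in Q, v y ∂μ) / μ Q) ^ s * ((∫⁻ y in Q, v y ^ (-s) ∂μ) / μ Q) ≤ K) →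
      ∀ c : ℝ≥0∞, μ.withDensity v {x | ∃ Q ∈ F, x ∈ Q ∧ v x < c * ((∫⁻ y in Q, v y ∂μ) / μ Q)} ≤
        C * c ^ (1 + s) * μ.withDensity v (⋃ Q ∈ F, Q) := by
  -- Chosen so that `s * p = 1 + s`: then `h = v ^ s` has `h ^ p * v ^ (-s) = v`, and the `p`-th
  -- power norm of `h` for the dual measure `ν` is the `v`-measure.
  set p : ℝ := (1 + s) / s with hp
  have hp1 : 1 < p := by rw [hp, lt_div_iff₀ hs]; linarith
  have hsp : s * p = 1 + s := by rw [hp]; field_simp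
  obtain ⟨C, hC⟩ := exists_lintegral_familyMaximal_rpow_le hp1
  refine ⟨K ^ p * C, fun {X} _ μ v hv hv0 hvt F hF hm hμ0 hμt hA c => ?_⟩
  have hvs : Measurable fun x => v x ^ (-s) := hv.pow_const _
  have hvs0 : ∀ x, v x ^ (-s) ≠ 0 := fun x => (ENNReal.rpow_pos (pos_iff_ne_zero.2 (hv0 x)) (hvt x)).ne'
  set ν := μ.withDensity fun x => v x ^ (-s) with hν
  have hU : MeasurableSet (⋃ Q ∈ F, Q) := F.measurableSet_biUnion hm
  set h : X → ℝ≥0∞ := (⋃ Q ∈ F, Q).indicator fun x => v x ^ s with hh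
  have hhm : Measurable h := (hv.pow_const _).indicator hU
  have hνQ : ∀ Q ∈ F, ν Q = ∫⁻ y in Q, v y ^ (-s) ∂μ := fun Q hQ => withDensity_apply _ (hm Q hQ)
  have hcancel : ∀ x, v x ^ (-s) * v x ^ s = 1 := fun x => by
    rw [← ENNReal.rpow_add _ _ (hv0 x) (hvt x)]; simp
  have hν0 : ∀ Q ∈ F, ν Q ≠ 0 := fun Q hQ => by
    rw [hνQ Q hQ]
    intro h0
    rw [lintegral_eq_zero_iff hvs] at h0
    refine hμ0 Q hQ ?_
    rw [← Measure.restrict_apply_univ, ← nonpos_iff_eq_zero]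
    refine (measure_mono fun x _ => ?_).trans (ae_iff.1 h0).le
    exact hvs0 x
  have hvQ0 : ∀ Q ∈ F, (∫⁻ y in Q, v y ∂μ) / μ Q ≠ 0 := fun Q hQ => by
    refine (ENNReal.div_pos (fun h0 => hμ0 Q hQ ?_) (hμt Q hQ)).ne'
    rw [lintegral_eq_zero_iff hv] at h0
    rw [← Measure.restrict_apply_univ, ← nonpos_iff_eq_zero]
    refine (measure_mono fun x _ => ?_).trans (ae_iff.1 h0).le
    exact hv0 x
  have hνt : ∀ Q ∈ F, ν Q ≠ ∞ := fun Q hQ ht => by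
    have := hA Q hQ
    rw [← hνQ Q hQ, ht, ENNReal.top_div_of_ne_top (hμt Q hQ), ENNReal.mul_top] at this
    · exact absurd this (by simp)
    · intro h0
      rcases ENNReal.rpow_eq_zero_iff.1 h0 with h1 | h1
      · exact hvQ0 Q hQ h1.1
      · linarith [h1.2]
  -- Hence the `ν`-average of `h` is `μ Q / ν Q`, which the `A_p` condition bounds below by a
  -- multiple of the `s`-th power of the average of `v`.
  have havg : ∀ Q ∈ F, ∫⁻ y in Q, h y ∂ν = μ Q := fun Q hQ => by
    rw [hν, setLIntegral_withDensity_eq_setLIntegral_mul _ hvs hhm (hm Q hQ),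
      ← setLIntegral_one]
    refine setLIntegral_congr_fun (hm Q hQ) fun x hx => ?_
    have hxU : x ∈ ⋃ Q ∈ F, Q := Set.mem_biUnion hQ hx
    simp only [Pi.mul_apply, hh, Set.indicator_of_mem hxU, hcancel]
  have hfin : ∀ x, familyMaximal ν F h x ≠ ∞ := fun x ht => by
    have h1 : ¬ (familyMaximal ν F h x < ∞) := by simp [ht]
    refine h1 ((Finset.sup_lt_iff (by simp)).2 fun Q hQ => ?_)
    by_cases hx : x ∈ Q
    · rw [Set.indicator_of_mem hx, havg Q hQ]
      exact ENNReal.div_lt_top (hμt Q hQ) (hν0 Q hQ)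
    · simp [hx]
  set E := {x | ∃ Q ∈ F, x ∈ Q ∧ v x < c * ((∫⁻ y in Q, v y ∂μ) / μ Q)} with hE
  have hEm : MeasurableSet E := by
    have : E = ⋃ Q ∈ F, Q ∩ {x | v x < c * ((∫⁻ y in Q, v y ∂μ) / μ Q)} := by
      ext x
      simp only [hE, Set.mem_ofPred_eq, Set.mem_iUnion, Set.mem_inter_iff, exists_prop]
    rw [this]
    exact F.measurableSet_biUnion fun Q hQ => (hm Q hQ).inter (measurableSet_lt hv measurable_const)
  have hmm : Measurable fun x => familyMaximal ν F h x ^ p :=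
    (measurable_familyMaximal ν h hm).pow_const p
  -- Raise `v x < c * average` to the power `1 + s`, dominate the average by the maximal function,
  -- then multiply by `v x ^ (-s)`, which becomes the density of `ν`.
  have hpt : ∀ x ∈ E, v x ≤ c ^ (1 + s) * K ^ p *
      (v x ^ (-s) * familyMaximal ν F h x ^ p) := by
    rintro x ⟨Q, hQ, hx, hlt⟩
    have h1 : ((∫⁻ y in Q, v y ∂μ) / μ Q) ^ s ≤ K * familyMaximal ν F h x := by
      refine le_trans ?_ (mul_le_mul_right (le_familyMaximal hQ hx) _)
      have h2 := hA Q hQ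
      rw [← hνQ Q hQ] at h2
      rw [havg Q hQ, ← ENNReal.inv_div (Or.inl (hμt Q hQ)) (Or.inl (hμ0 Q hQ)), ← div_eq_mul_inv,
        ENNReal.le_div_iff_mul_le]
      · exact h2
      · exact Or.inl (ENNReal.div_pos (hν0 Q hQ) (hμt Q hQ)).ne'
      · exact Or.inl (ENNReal.div_lt_top (hνt Q hQ) (hμ0 Q hQ)).ne
    have h2 : v x ^ (1 + s) ≤ c ^ (1 + s) * (K ^ p * familyMaximal ν F h x ^ p) := by
      refine (ENNReal.rpow_le_rpow hlt.le (by linarith)).trans ?_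
      rw [ENNReal.mul_rpow_of_nonneg _ _ (by linarith), ← hsp,
        ENNReal.rpow_mul ((∫⁻ y in Q, v y ∂μ) / μ Q) s p,
        ← ENNReal.mul_rpow_of_nonneg _ _ (by linarith : (0 : ℝ) ≤ p)]
      exact mul_le_mul_right (ENNReal.rpow_le_rpow h1 (by linarith)) _
    calc v x = v x ^ (1 + s) * v x ^ (-s) := by
          rw [← ENNReal.rpow_add _ _ (hv0 x) (hvt x)]; simp
      _ ≤ c ^ (1 + s) * (K ^ p * familyMaximal ν F h x ^ p) * v x ^ (-s) := mul_le_mul_left h2 _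
      _ = _ := by ring
  calc μ.withDensity v E = ∫⁻ x in E, v x ∂μ := withDensity_apply _ hEm
    _ ≤ ∫⁻ x in E, c ^ (1 + s) * K ^ p * (v x ^ (-s) * familyMaximal ν F h x ^ p) ∂μ :=
        setLIntegral_mono' hEm hpt
    _ ≤ ∫⁻ x, c ^ (1 + s) * K ^ p * (v x ^ (-s) * familyMaximal ν F h x ^ p) ∂μ :=
        setLIntegral_le_lintegral _ _
    _ = c ^ (1 + s) * K ^ p * ∫⁻ x, familyMaximal ν F h x ^ p ∂ν := by
        rw [hν, lintegral_withDensity_eq_lintegral_mul _ hvs hmm,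
          ← lintegral_const_mul _ (hvs.mul hmm)]
        rfl
    _ ≤ c ^ (1 + s) * K ^ p * (C * ∫⁻ x, h x ^ p ∂ν) :=
        mul_le_mul_right (hC F hF hm ν hνt h hhm hfin) _
    _ = _ := by
        have : ∫⁻ x, h x ^ p ∂ν = μ.withDensity v (⋃ Q ∈ F, Q) := by
          rw [hν, lintegral_withDensity_eq_lintegral_mul _ hvs (hhm.pow_const p),
            withDensity_apply _ hU, ← lintegral_indicator hU]
          refine lintegral_congr fun x => ?_
          by_cases hx : x ∈ ⋃ Q ∈ F, Q
          · simp only [Pi.mul_apply, hh, Set.indicator_of_mem hx]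
            rw [← ENNReal.rpow_mul, hsp, ← ENNReal.rpow_add _ _ (hv0 x) (hvt x)]
            simp
          · simp only [Pi.mul_apply, hh, Set.indicator_of_notMem hx]
            rw [ENNReal.zero_rpow_of_pos (by linarith), mul_zero]
        rw [this, ENNReal.coe_mul, ENNReal.coe_rpow_of_nonneg _ (by linarith)]
        ring

/-- Mixed weak type inequality over a finite laminar family. -/
lemma exists_withDensity_lt_average_le {s : ℝ} (hs : 0 < s) (K : ℝ≥0) : ∃ C : ℝ≥0,
    ∀ {X : Type*} [MeasurableSpace X] (μ : Measure X) (v g : X → ℝ≥0∞), Measurable v →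
      (∀ x, v x ≠ 0) → (∀ x, v x ≠ ∞) → ∀ F : Finset (Set X), IsLaminar (F : Set (Set X)) →
      (∀ Q ∈ F, MeasurableSet Q) → (∀ Q ∈ F, μ Q ≠ 0) → (∀ Q ∈ F, μ Q ≠ ∞) →
      (∀ Q ∈ F, ((∫⁻ y in Q, v y ∂μ) / μ Q) ^ s * ((∫⁻ y in Q, v y ^ (-s) ∂μ) / μ Q) ≤ K) →
      μ.withDensity v {x | ∃ Q ∈ F, x ∈ Q ∧ v x < (∫⁻ y in Q, g y ∂μ) / μ Q} ≤
        C * ∫⁻ x, g x ∂μ := by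
  classical
  obtain ⟨C, hC⟩ := exists_withDensity_lt_mul_average_le hs K
  set q : ℝ≥0∞ := (2 : ℝ≥0∞) ^ (-s) with hq
  have hq1 : q < 1 := ENNReal.rpow_lt_one_of_one_lt_of_neg (by norm_num) (by linarith)
  have hqfin : (1 - q)⁻¹ ≠ ∞ := ENNReal.inv_ne_top.2 (tsub_pos_of_lt hq1).ne'
  have h2 : (2 : ℝ≥0∞) ≠ 0 := two_ne_zero
  have h2t : (2 : ℝ≥0∞) ≠ ∞ := ENNReal.ofNat_ne_top
  -- The 1 comes from the cells in `H`, the other term from summing `2 * C * q ^ i` over the classes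
  -- `G i`.
  refine ⟨1 + 2 * C * ((1 - q)⁻¹).toNNReal,
    fun {X} _ μ v g hv hv0 hvt F hF hm hμ0 hμt hA => ?_⟩
  set G : ℕ → Finset (Set X) := fun i => F.filter fun Q =>
    2 ^ i * ((∫⁻ y in Q, g y ∂μ) / μ Q) ≤ (∫⁻ y in Q, v y ∂μ) / μ Q ∧
    (∫⁻ y in Q, v y ∂μ) / μ Q ≤ 2 ^ (i + 1) * ((∫⁻ y in Q, g y ∂μ) / μ Q) with hG
  set H : Finset (Set X) := F.filter fun Q =>
    (∫⁻ y in Q, v y ∂μ) / μ Q ≤ (∫⁻ y in Q, g y ∂μ) / μ Q with hH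
  have hGF : ∀ i, G i ⊆ F := fun i => Finset.filter_subset _ _
  have hHF : H ⊆ F := Finset.filter_subset _ _
  have hvQt : ∀ Q ∈ F, (∫⁻ y in Q, v y ∂μ) / μ Q ≠ ∞ := fun Q hQ ht => by
    have := hA Q hQ
    rw [ht, ENNReal.top_rpow_of_pos hs, ENNReal.top_mul] at this
    · exact absurd this (by simp)
    · refine (ENNReal.div_pos (fun h0 => hμ0 Q hQ ?_) (hμt Q hQ)).ne'
      rw [lintegral_eq_zero_iff (hv.pow_const _)] at h0
      rw [← Measure.restrict_apply_univ, ← nonpos_iff_eq_zero]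
      refine (measure_mono fun x _ => ?_).trans (ae_iff.1 h0).le
      exact (ENNReal.rpow_pos (pos_iff_ne_zero.2 (hv0 x)) (hvt x)).ne'
  have hmul : ∀ Q ∈ F, ∀ a : ℝ≥0∞, a ≠ ∞ →
      (∫⁻ y in Q, v y ∂μ) / μ Q ≤ a * ((∫⁻ y in Q, g y ∂μ) / μ Q) →
      1 * μ.withDensity v Q ≤ ∫⁻ y in Q, a * g y ∂μ := fun Q hQ a ha h => by
    rw [one_mul, withDensity_apply _ (hm Q hQ), lintegral_const_mul' _ _ ha]
    rw [← mul_div_assoc] at h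
    have h' := (ENNReal.div_le_iff (hμ0 Q hQ) (hμt Q hQ)).1 h
    rwa [ENNReal.div_mul_cancel (hμ0 Q hQ) (hμt Q hQ)] at h'
  have hcover : {x | ∃ Q ∈ F, x ∈ Q ∧ v x < (∫⁻ y in Q, g y ∂μ) / μ Q} ⊆
      (⋃ Q ∈ H, Q) ∪ ⋃ i : ℕ, {x | ∃ Q ∈ G i, x ∈ Q ∧
        v x < (2 ^ i)⁻¹ * ((∫⁻ y in Q, v y ∂μ) / μ Q)} := by
    rintro x ⟨Q, hQ, hx, hlt⟩
    set a := (∫⁻ y in Q, v y ∂μ) / μ Q with ha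
    set b := (∫⁻ y in Q, g y ∂μ) / μ Q with hb
    rcases le_or_gt a b with hab | hab
    · exact Or.inl (Set.mem_biUnion (Finset.mem_filter.2 ⟨hQ, hab⟩) hx)
    right
    have hb0 : b ≠ 0 := (pos_of_gt hlt).ne'
    have hbt : b ≠ ∞ := (hab.trans_le le_top).ne
    have hr1 : 1 ≤ a / b := by
      rw [ENNReal.le_div_iff_mul_le (Or.inl hb0) (Or.inl hbt), one_mul]; exact hab.le
    have hrt : a / b ≠ ∞ := (ENNReal.div_lt_top (hvQt Q hQ) hb0).ne
    obtain ⟨n, hn1, hn2⟩ := ENNReal.exists_mem_Ico_zpow (by positivity : a / b ≠ 0) hrt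
      (by norm_num : (1 : ℝ≥0∞) < 2) h2t
    have hn : 0 ≤ n := by
      by_contra hneg
      have : (2 : ℝ≥0∞) ^ (n + 1) ≤ 2 ^ (0 : ℤ) := ENNReal.zpow_le_of_le (by norm_num) (by omega)
      rw [zpow_zero] at this
      exact absurd (hr1.trans_lt hn2) (not_lt.2 this)
    obtain ⟨i, rfl⟩ := Int.eq_ofNat_of_zero_le hn
    rw [zpow_natCast, ENNReal.le_div_iff_mul_le (Or.inl hb0) (Or.inl hbt)] at hn1
    have hn2' : a ≤ 2 ^ (i + 1) * b := by
      have := hn2.le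
      rwa [show ((i : ℤ) + 1) = ((i + 1 : ℕ) : ℤ) by push_cast; ring, zpow_natCast,
        ENNReal.div_le_iff hb0 hbt] at this
    refine Set.mem_iUnion.2 ⟨i, Q, Finset.mem_filter.2 ⟨hQ, hn1, hn2'⟩, hx, hlt.trans_le ?_⟩
    rw [mul_comm, ← div_eq_mul_inv, ENNReal.le_div_iff_mul_le (Or.inl (by positivity))
      (Or.inl (ENNReal.pow_ne_top h2t)), mul_comm]
    exact hn1
  have hHle : μ.withDensity v (⋃ Q ∈ H, Q) ≤ ∫⁻ x, g x ∂μ := by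
    have := (hF.mono (Finset.coe_subset.2 hHF)).measure_biUnion_le (fun Q hQ => hm Q (hHF hQ))
      (μ := μ) (ν := μ.withDensity v) (φ := fun x => 1 * g x) (c := 1) fun Q hQ =>
        hmul Q (hHF hQ) 1 (by simp) (by simpa using (Finset.mem_filter.1 hQ).2)
    simp only [one_mul] at this
    exact this.trans (setLIntegral_le_lintegral _ _)
  have hGle : ∀ i, μ.withDensity v (⋃ Q ∈ G i, Q) ≤ 2 ^ (i + 1) * ∫⁻ x, g x ∂μ := fun i => by
    have hi : (2 : ℝ≥0∞) ^ (i + 1) ≠ ∞ := ENNReal.pow_ne_top h2t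
    have := (hF.mono (Finset.coe_subset.2 (hGF i))).measure_biUnion_le
      (fun Q hQ => hm Q (hGF i hQ))
      (μ := μ) (ν := μ.withDensity v) (φ := fun x => 2 ^ (i + 1) * g x) (c := 1) fun Q hQ =>
        hmul Q (hGF i hQ) _ hi (Finset.mem_filter.1 hQ).2.2
    rw [one_mul] at this
    refine (this.trans (setLIntegral_le_lintegral _ _)).trans (le_of_eq ?_)
    rw [lintegral_const_mul' _ _ hi]
  have hterm : ∀ i : ℕ, μ.withDensity v {x | ∃ Q ∈ G i, x ∈ Q ∧
      v x < (2 ^ i)⁻¹ * ((∫⁻ y in Q, v y ∂μ) / μ Q)} ≤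
      2 * C * (∫⁻ x, g x ∂μ) * q ^ i := fun i => by
    refine (hC μ v hv hv0 hvt (G i) (hF.mono (Finset.coe_subset.2 (hGF i)))
      (fun Q hQ => hm Q (hGF i hQ)) (fun Q hQ => hμ0 Q (hGF i hQ))
      (fun Q hQ => hμt Q (hGF i hQ)) (fun Q hQ => hA Q (hGF i hQ)) _).trans ?_
    refine (mul_le_mul_right (hGle i) _).trans (le_of_eq ?_)
    have hpow0 : (2 : ℝ≥0∞) ^ i ≠ 0 := by positivity
    have hpowt : (2 : ℝ≥0∞) ^ i ≠ ∞ := ENNReal.pow_ne_top h2t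
    -- The first power of `2 ^ (-i)` cancels the growth in `hGle`; the extra exponent `s` gives the
    -- convergent ratio `q`.
    have e : ((2 : ℝ≥0∞) ^ i)⁻¹ ^ (1 + s) = ((2 : ℝ≥0∞) ^ i)⁻¹ * q ^ i := by
      rw [ENNReal.rpow_add _ _ (ENNReal.inv_ne_zero.2 hpowt) (ENNReal.inv_ne_top.2 hpow0),
        ENNReal.rpow_one, hq, ENNReal.inv_rpow, ← ENNReal.rpow_neg, ← ENNReal.rpow_natCast,
        ← ENNReal.rpow_natCast, ← ENNReal.rpow_mul, ← ENNReal.rpow_mul, mul_comm (i : ℝ)]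
    rw [e, pow_succ]
    calc (C : ℝ≥0∞) * ((2 ^ i)⁻¹ * q ^ i) * (2 ^ i * 2 * ∫⁻ x, g x ∂μ)
        = ((2 ^ i)⁻¹ * 2 ^ i) * (2 * C * (∫⁻ x, g x ∂μ) * q ^ i) := by ring
      _ = _ := by rw [ENNReal.inv_mul_cancel hpow0 hpowt, one_mul]
  refine (measure_mono hcover).trans ((measure_union_le _ _).trans ?_)
  refine (add_le_add hHle ((measure_iUnion_le _).trans (ENNReal.tsum_le_tsum hterm))).trans ?_
  rw [ENNReal.tsum_mul_left, ENNReal.tsum_geometric]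
  push_cast
  rw [ENNReal.coe_toNNReal hqfin]
  exact le_of_eq (by ring)

/-- Mixed weak type inequality over a countable laminar family. -/
lemma exists_withDensity_lt_average_le_of_countable {s : ℝ} (hs : 0 < s) (K : ℝ≥0) :
    ∃ C : ℝ≥0, ∀ {X : Type*} [MeasurableSpace X] (μ : Measure X) (v g : X → ℝ≥0∞),
      Measurable v → (∀ x, v x ≠ 0) → (∀ x, v x ≠ ∞) →
      ∀ F : Set (Set X), F.Countable → IsLaminar F →
      (∀ Q ∈ F, MeasurableSet Q) → (∀ Q ∈ F, μ Q ≠ 0) → (∀ Q ∈ F, μ Q ≠ ∞) →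
      (∀ Q ∈ F, ((∫⁻ y in Q, v y ∂μ) / μ Q) ^ s * ((∫⁻ y in Q, v y ^ (-s) ∂μ) / μ Q) ≤ K) →
      μ.withDensity v {x | ∃ Q ∈ F, x ∈ Q ∧ v x < (∫⁻ y in Q, g y ∂μ) / μ Q} ≤
        C * ∫⁻ x, g x ∂μ := by
  classical
  obtain ⟨C, hC⟩ := exists_withDensity_lt_average_le hs K
  refine ⟨C, fun {X} _ μ v g hv hv0 hvt F hc hF hm hμ0 hμt hA => ?_⟩
  rcases F.eq_empty_or_nonempty with rfl | hne
  · simp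
  obtain ⟨e, rfl⟩ := hc.exists_eq_range hne
  set G : ℕ → Finset (Set X) := fun n => (Finset.range n).image e with hG
  have hGF : ∀ n, (G n : Set (Set X)) ⊆ Set.range e := fun n => by
    simp [hG, Set.subset_def]
  have hset : {x | ∃ Q ∈ Set.range e, x ∈ Q ∧ v x < (∫⁻ y in Q, g y ∂μ) / μ Q} =
      ⋃ n, {x | ∃ Q ∈ G n, x ∈ Q ∧ v x < (∫⁻ y in Q, g y ∂μ) / μ Q} := by
    ext x
    simp only [Set.mem_ofPred_eq, Set.mem_iUnion]
    constructor
    · rintro ⟨_, ⟨i, rfl⟩, h⟩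
      exact ⟨i + 1, e i, Finset.mem_image_of_mem _ (by simp), h⟩
    · rintro ⟨n, Q, hQ, h⟩
      exact ⟨Q, hGF n hQ, h⟩
  have hmono : Monotone fun n => {x | ∃ Q ∈ G n, x ∈ Q ∧ v x < (∫⁻ y in Q, g y ∂μ) / μ Q} := by
    rintro m n hmn x ⟨Q, hQ, h⟩
    exact ⟨Q, Finset.image_subset_image (Finset.range_mono hmn) hQ, h⟩
  rw [hset, hmono.measure_iUnion]
  exact iSup_le fun n => hC μ v g hv hv0 hvt (G n) (hF.mono (hGF n)) (fun Q hQ => hm Q (hGF n hQ))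
    (fun Q hQ => hμ0 Q (hGF n hQ)) (fun Q hQ => hμt Q (hGF n hQ)) fun Q hQ => hA Q (hGF n hQ)

/-! ### Shifted dyadic grids and the one-third trick -/

/-- The shift, relative to the side length, of the dyadic intervals of generation `k`. -/
def gridShift (b : Bool) (k : ℤ) : ℝ := if b then (-1) ^ k / 3 else 0

/-- The index of the cell of side length `2 ^ k` of the grid `α` that contains `x`. -/
def gridIndex {d : ℕ} (α : Fin d → Bool) (k : ℤ) (x : EuclideanSpace ℝ (Fin d)) (i : Fin d) : ℤ :=
  ⌊x i / 2 ^ k + gridShift (α i) k⌋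

/-- The cells of side length `2 ^ k` of the grid `α`. -/
def gridCell {d : ℕ} (α : Fin d → Bool) (k : ℤ) (n : Fin d → ℤ) :
    Set (EuclideanSpace ℝ (Fin d)) :=
  {x | gridIndex α k x = n}

/-- The center of a grid cell. -/
def cellCenter {d : ℕ} (α : Fin d → Bool) (k : ℤ) (n : Fin d → ℤ) : EuclideanSpace ℝ (Fin d) :=
  WithLp.toLp 2 fun i => 2 ^ k * (n i - gridShift (α i) k + 1 / 2)

/-- The radius of a grid cell. -/
def cellRadius (d : ℕ) (k : ℤ) : ℝ := √(d : ℝ) * 2 ^ k / 2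

lemma cellRadius_pos {d : ℕ} (hd : 0 < d) (k : ℤ) : 0 < cellRadius d k := by
  unfold cellRadius; positivity

/-- The alternating sign makes the shifted grids nested: doubling `(-1) ^ (k + 1) / 3` gives `(-1) ^
k / 3` up to the integer `e = (-1) ^ k`, so each index determines the index one generation up. -/
lemma exists_gridShift_succ (b : Bool) (k : ℤ) : ∃ e : ℤ, ∀ z : ℝ,
    z / 2 ^ (k + 1) + gridShift b (k + 1) = (z / 2 ^ k + gridShift b k - e) / (2 : ℕ) := by
  have h2 : (2 : ℝ) ^ (k + 1) = 2 ^ k * 2 := zpow_add_one₀ two_ne_zero k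
  cases b
  · exact ⟨0, fun z => by simp [gridShift, h2, div_div]⟩
  · rcases Int.even_or_odd k with hk | hk
    · refine ⟨1, fun z => ?_⟩
      simp only [gridShift, if_true, h2, hk.neg_one_zpow, (hk.add_one).neg_one_zpow]
      push_cast; field_simp; ring
    · refine ⟨-1, fun z => ?_⟩
      simp only [gridShift, if_true, h2, hk.neg_one_zpow, (hk.add_one).neg_one_zpow]
      push_cast; field_simp; ring

lemma gridIndex_congr {d : ℕ} {α : Fin d → Bool} {k k' : ℤ} (hk : k ≤ k')
    {x y : EuclideanSpace ℝ (Fin d)} (h : gridIndex α k x = gridIndex α k y) :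
    gridIndex α k' x = gridIndex α k' y := by
  induction k', hk using Int.leInduction with
  | base => exact h
  | succ m _ ih =>
    funext i
    obtain ⟨e, he⟩ := exists_gridShift_succ (α i) m
    have hi := congrFun ih i
    simp only [gridIndex] at hi ⊢
    rw [he, he, Int.floor_div_natCast, Int.floor_div_natCast, Int.floor_sub_intCast,
      Int.floor_sub_intCast, hi]

lemma isLaminar_gridCell {d : ℕ} (α : Fin d → Bool) {F : Set (Set (EuclideanSpace ℝ (Fin d)))}
    (hF : ∀ Q ∈ F, ∃ k n, Q = gridCell α k n) : IsLaminar F := by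
  have key : ∀ k k' : ℤ, k ≤ k' → ∀ n n' : Fin d → ℤ,
      Disjoint (gridCell α k n) (gridCell α k' n') ∨ gridCell α k n ⊆ gridCell α k' n' := by
    intro k k' hk n n'
    by_cases h : Disjoint (gridCell α k n) (gridCell α k' n')
    · exact Or.inl h
    obtain ⟨x, hx, hx'⟩ := Set.not_disjoint_iff.1 h
    refine Or.inr fun y hy => ?_
    have h1 : gridIndex α k y = gridIndex α k x :=
      (show gridIndex α k y = n from hy).trans (show gridIndex α k x = n from hx).symm
    exact (gridIndex_congr hk h1).trans hx'
  intro P hP Q hQ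
  obtain ⟨k, n, rfl⟩ := hF P hP
  obtain ⟨k', n', rfl⟩ := hF Q hQ
  rcases le_total k k' with h | h
  · exact (key k k' h n n').imp_right Or.inl
  · exact (key k' k h n' n).imp (fun h => h.symm) Or.inr

lemma mem_gridCell_iff {d : ℕ} {α : Fin d → Bool} {k : ℤ} {n : Fin d → ℤ}
    {x : EuclideanSpace ℝ (Fin d)} : x ∈ gridCell α k n ↔
      ∀ i, cellCenter α k n i - 2 ^ k / 2 ≤ x i ∧ x i < cellCenter α k n i + 2 ^ k / 2 := by
  have hk : (0 : ℝ) < 2 ^ k := by positivity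
  rw [gridCell, Set.mem_ofPred_eq, funext_iff]
  refine forall_congr' fun i => ?_
  simp only [gridIndex, cellCenter, Int.floor_eq_iff, ← sub_le_iff_le_add, ← lt_sub_iff_add_lt]
  rw [le_div_iff₀ hk, div_lt_iff₀ hk]
  constructor <;> rintro ⟨h1, h2⟩ <;> constructor <;> nlinarith

lemma gridCell_eq_preimage {d : ℕ} (α : Fin d → Bool) (k : ℤ) (n : Fin d → ℤ) :
    gridCell α k n = (WithLp.ofLp : EuclideanSpace ℝ (Fin d) → Fin d → ℝ) ⁻¹'
      (Set.univ.pi fun i => Set.Ico (cellCenter α k n i - 2 ^ k / 2)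
        (cellCenter α k n i + 2 ^ k / 2)) := by
  ext x
  rw [mem_gridCell_iff]
  simp

lemma cube_eq_preimage {d : ℕ} (x : EuclideanSpace ℝ (Fin d)) (r : ℝ) :
    cube x r = (WithLp.ofLp : EuclideanSpace ℝ (Fin d) → Fin d → ℝ) ⁻¹'
      (Set.Icc (fun i => x i - r / √(d : ℝ)) (fun i => x i + r / √(d : ℝ))) := by
  ext y
  simp only [cube, Set.mem_ofPred_eq, Set.mem_preimage, Set.mem_Icc, Pi.le_def, abs_le,
    ← forall_and]
  refine forall_congr' fun i => ?_
  constructor <;> rintro ⟨h1, h2⟩ <;> constructor <;> linarith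

lemma cellRadius_div {d : ℕ} (hd : 0 < d) (k : ℤ) : cellRadius d k / √(d : ℝ) = 2 ^ k / 2 := by
  have : (√(d : ℝ)) ≠ 0 := by positivity
  unfold cellRadius; field_simp

lemma measurableSet_gridCell {d : ℕ} (α : Fin d → Bool) (k : ℤ) (n : Fin d → ℤ) :
    MeasurableSet (gridCell α k n) := by
  rw [gridCell_eq_preimage]
  exact (PiLp.volume_preserving_ofLp (Fin d)).measurable
    (MeasurableSet.univ_pi fun i => measurableSet_Ico)

/-- Cells are half-open to partition space, whereas the weight conditions concern closed cubes; the
difference is a null set. -/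
lemma gridCell_ae_eq_cube {d : ℕ} (hd : 0 < d) (α : Fin d → Bool) (k : ℤ) (n : Fin d → ℤ) :
    gridCell α k n =ᵐ[volume] cube (cellCenter α k n) (cellRadius d k) := by
  rw [gridCell_eq_preimage, cube_eq_preimage, cellRadius_div hd]
  exact (PiLp.volume_preserving_ofLp (Fin d)).quasiMeasurePreserving.preimage_ae_eq
    Measure.univ_pi_Ico_ae_eq_Icc

lemma volume_cube {d : ℕ} (x : EuclideanSpace ℝ (Fin d)) (r : ℝ) :
    volume (cube x r) = ENNReal.ofReal (2 * (r / √(d : ℝ))) ^ d := by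
  rw [cube_eq_preimage, (PiLp.volume_preserving_ofLp (Fin d)).measure_preimage
    measurableSet_Icc.nullMeasurableSet, Real.volume_Icc_pi]
  simp only [add_sub_sub_cancel, Finset.prod_const, Finset.card_univ, Fintype.card_fin, two_mul]

lemma norm_sub_le_of_mem_cube {d : ℕ} (hd : 0 < d) {x y : EuclideanSpace ℝ (Fin d)} {r : ℝ}
    (hr : 0 ≤ r) (h : y ∈ cube x r) : ‖y - x‖ ≤ r := by
  have hd' : (0 : ℝ) < d := by exact_mod_cast hd
  rw [EuclideanSpace.norm_eq]
  refine Real.sqrt_le_iff.2 ⟨hr, ?_⟩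
  calc ∑ i, ‖(y - x) i‖ ^ 2 ≤ ∑ _i : Fin d, (r / √(d : ℝ)) ^ 2 := by
        refine Finset.sum_le_sum fun i _ => ?_
        exact pow_le_pow_left₀ (norm_nonneg _) (by simpa using h i) 2
    _ = r ^ 2 := by
        rw [Finset.sum_const, div_pow, Real.sq_sqrt hd'.le]
        simp; field_simp

lemma norm_sub_cellCenter_le {d : ℕ} (hd : 0 < d) {α : Fin d → Bool} {k : ℤ} {n : Fin d → ℤ}
    {x : EuclideanSpace ℝ (Fin d)} (h : x ∈ gridCell α k n) :
    ‖x - cellCenter α k n‖ ≤ cellRadius d k := by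
  refine norm_sub_le_of_mem_cube hd (cellRadius_pos hd k).le fun i => ?_
  rw [cellRadius_div hd, abs_le]
  have := mem_gridCell_iff.1 h i
  constructor <;> linarith

/-- If the floors differ, an integer separates `y` from `a`. -/
lemma exists_abs_sub_le_of_floor_ne {a y δ : ℝ} (h : |y - a| ≤ δ) (hne : ⌊y⌋ ≠ ⌊a⌋) :
    ∃ m : ℤ, |a - m| ≤ δ := by
  rw [abs_le] at h
  rcases lt_or_gt_of_ne hne with hlt | hlt
  · refine ⟨⌊a⌋, ?_⟩
    have h1 := Int.floor_lt.1 hlt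
    have h2 := Int.floor_le a
    rw [abs_le]; constructor <;> linarith
  · refine ⟨⌊y⌋, ?_⟩
    have h1 := Int.floor_lt.1 hlt
    have h2 := Int.floor_le y
    rw [abs_le]; constructor <;> linarith

/-- An interval of length less than a third of the side length lies in a cell of one of the two
one-dimensional grids. -/
lemma exists_forall_floor_eq (k : ℤ) {a δ : ℝ} (hδ : δ < 1 / 6) : ∃ b : Bool, ∀ y, |y - a| ≤ δ →
    ⌊y + gridShift b k⌋ = ⌊a + gridShift b k⌋ := by
  -- If both grids failed, `a` and `a ± 1/3` would each lie within `δ < 1/6` of an integer, placing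
  -- `1/3` at distance less than `1/3` from an integer.
  by_contra! hcon
  obtain ⟨y, hy, hne⟩ := hcon false
  obtain ⟨z, hz, hne'⟩ := hcon true
  obtain ⟨m, hm⟩ := exists_abs_sub_le_of_floor_ne (δ := δ) (by simpa using hy) hne
  obtain ⟨n, hn⟩ := exists_abs_sub_le_of_floor_ne (δ := δ) (by simpa using hz) hne'
  simp only [gridShift, if_true, Bool.false_eq_true, if_false, add_zero] at hm hn
  rw [abs_le] at hm hn
  rcases Int.even_or_odd k with hk | hk
  · rw [hk.neg_one_zpow] at hn
    have h1 : (3 * (n - m) - 1 : ℝ) < 1 := by linarith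
    have h2 : (-1 : ℝ) < 3 * (n - m) - 1 := by linarith
    have h1' : 3 * (n - m) - 1 < 1 := by exact_mod_cast h1
    have h2' : -1 < 3 * (n - m) - 1 := by exact_mod_cast h2
    omega
  · rw [hk.neg_one_zpow] at hn
    have h1 : (3 * (n - m) + 1 : ℝ) < 1 := by linarith
    have h2 : (-1 : ℝ) < 3 * (n - m) + 1 := by linarith
    have h1' : 3 * (n - m) + 1 < 1 := by exact_mod_cast h1
    have h2' : -1 < 3 * (n - m) + 1 := by exact_mod_cast h2
    omega

/-- Every cube is contained in a cell of comparable size of one of the shifted grids. -/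
lemma exists_cube_subset_gridCell {d : ℕ} (hd : 0 < d) (x : EuclideanSpace ℝ (Fin d)) {r : ℝ}
    (hr : 0 < r) : ∃ (α : Fin d → Bool) (k : ℤ) (n : Fin d → ℤ), cube x r ⊆ gridCell α k n ∧
      cellRadius d k ≤ 6 * r ∧ volume (gridCell α k n) ≤ 6 ^ d * volume (cube x r) := by
  have hsd : 0 < √(d : ℝ) := by positivity
  set h := r / √(d : ℝ) with hh
  have hpos : 0 < h := by positivity
  -- The cube has side `2 * h`; the cell side `2 ^ (m + 1)` exceeds three times that and is at most
  -- six times it, whence the factors 6.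
  obtain ⟨m, hm1, hm2⟩ := exists_mem_Ico_zpow (by positivity : 0 < 6 * h) (one_lt_two (α := ℝ))
  have hk0 : (0 : ℝ) < 2 ^ (m + 1) := by positivity
  have hk2 : (2 : ℝ) ^ (m + 1) ≤ 12 * h := by
    rw [zpow_add_one₀ two_ne_zero]; linarith
  have hδ : h / 2 ^ (m + 1) < 1 / 6 := by rw [div_lt_iff₀ hk0]; linarith
  choose α hα using fun i => exists_forall_floor_eq (m + 1) (a := x i / 2 ^ (m + 1)) hδ
  refine ⟨α, m + 1, gridIndex α (m + 1) x, fun y hy => funext fun i => hα i _ ?_, ?_, ?_⟩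
  · rw [← sub_div, abs_div, abs_of_pos hk0]
    exact div_le_div_of_nonneg_right (hy i) hk0.le
  · have : r = h * √(d : ℝ) := by rw [hh]; field_simp
    unfold cellRadius
    rw [this]; nlinarith
  · rw [measure_congr (gridCell_ae_eq_cube hd _ _ _), volume_cube, volume_cube, cellRadius_div hd,
      ← mul_pow]
    refine pow_le_pow_left₀ (zero_le) ?_ d
    rw [show (6 : ℝ≥0∞) = ENNReal.ofReal 6 by simp, ← ENNReal.ofReal_mul (by norm_num)]
    exact ENNReal.ofReal_le_ofReal (by linarith)

/-! ### Growth factors of the critical radius function -/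

/-- Comparison of the growth factors of a cube and of a larger cube of comparable size. -/
lemma one_add_div_le_of_norm_sub_le {d : ℕ} {ρ : EuclideanSpace ℝ (Fin d) → ℝ}
    (hρ : ∀ x, 0 < ρ x) {C₀ N : ℝ} (hC : 1 ≤ C₀) (hN : 1 ≤ N)
    (hlow : ∀ x y, C₀⁻¹ * ρ x * (1 + ‖x - y‖ / ρ x) ^ (-N) ≤ ρ y)
    {x c : EuclideanSpace ℝ (Fin d)} {r R A : ℝ} (hr : 0 < r) (hA : 1 ≤ A)
    (hRr : R ≤ A * r) (hxc : ‖x - c‖ ≤ R) :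
    R / ρ c ≤ C₀ * A ^ (N + 1) * (1 + r / ρ x) ^ (N + 1) := by
  have hx := hρ x
  set S := 1 + r / ρ x with hS
  have hS1 : 1 ≤ S := by rw [hS]; have : 0 < r / ρ x := by positivity
                         linarith
  have hAS : 0 < A * S := by positivity
  have h1 : 1 + ‖x - c‖ / ρ x ≤ A * S := by
    have : ‖x - c‖ / ρ x ≤ A * (r / ρ x) := by
      rw [← mul_div_assoc]; exact div_le_div_of_nonneg_right (hxc.trans hRr) hx.le
    rw [hS]; linarith
  have h2 : C₀⁻¹ * ρ x * (A * S) ^ (-N) ≤ ρ c := by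
    refine le_trans ?_ (hlow x c)
    refine mul_le_mul_of_nonneg_left ?_ (by positivity)
    exact Real.rpow_le_rpow_of_nonpos (by positivity) h1 (by linarith)
  have h3 : 0 < C₀⁻¹ * ρ x * (A * S) ^ (-N) := by positivity
  have h4 : R / ρ c ≤ A * r / (C₀⁻¹ * ρ x * (A * S) ^ (-N)) :=
    div_le_div₀ (by positivity) hRr h3 h2
  refine h4.trans ?_
  have h5 : A * r / (C₀⁻¹ * ρ x * (A * S) ^ (-N)) = C₀ * (A * S) ^ N * (A * (r / ρ x)) := by
    rw [Real.rpow_neg hAS.le]; field_simp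
  rw [h5, mul_assoc, mul_assoc, ← Real.mul_rpow (by positivity) (by positivity),
    Real.rpow_add_one hAS.ne']
  refine mul_le_mul_of_nonneg_left (mul_le_mul_of_nonneg_left ?_ (by positivity)) (by positivity)
  refine mul_le_mul_of_nonneg_left ?_ (by positivity)
  rw [hS]; linarith

/-- For the cells larger than the critical radius that contain a given point, the negative powers
of the growth factors are uniformly summable. -/
lemma exists_tsum_supercritical_le {d : ℕ} (hd : 0 < d) {ρ : EuclideanSpace ℝ (Fin d) → ℝ}
    (hρ : ∀ x, 0 < ρ x) {C₀ N : ℝ} (hC : 1 ≤ C₀) (hN : 1 ≤ N)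
    (hlow : ∀ x y, C₀⁻¹ * ρ x * (1 + ‖x - y‖ / ρ x) ^ (-N) ≤ ρ y)
    (hup : ∀ x y, ρ y ≤ C₀ * ρ x * (1 + ‖x - y‖ / ρ x) ^ (N / (N + 1))) :
    ∃ C : ℝ≥0, ∀ (α : Fin d → Bool) (x : EuclideanSpace ℝ (Fin d)), ∑' k : ℤ,
      (if ρ (cellCenter α k (gridIndex α k x)) < cellRadius d k then
        ENNReal.ofReal ((1 + cellRadius d k / ρ (cellCenter α k (gridIndex α k x))) ^ (-(N + 1)))
        else 0) ≤ C := by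
  obtain ⟨C, -, hCs⟩ := exists_tsum_zpow_rpow_le one_pos
  -- The product of the prefactor `C₀ * a` and the threshold `2 * C₀ / a` below; `a`, hence the
  -- point `x`, cancels.
  refine ⟨C * (2 * C₀ ^ 2).toNNReal, fun α x => ?_⟩
  have hsd : 0 < √(d : ℝ) := by positivity
  have hx := hρ x
  set a : ℝ := 2 * ρ x / √(d : ℝ) with ha
  have ha0 : 0 < a := by positivity
  have hratio : ∀ k : ℤ, cellRadius d k / ρ x = (a * 2 ^ (-k))⁻¹ := fun k => by
    rw [ha, cellRadius, zpow_neg]; field_simp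
  have hterm : ∀ k : ℤ,
      (if ρ (cellCenter α k (gridIndex α k x)) < cellRadius d k then
        ENNReal.ofReal ((1 + cellRadius d k / ρ (cellCenter α k (gridIndex α k x))) ^ (-(N + 1)))
        else 0) ≤ ENNReal.ofReal (C₀ * a) * (if (2 : ℝ≥0∞) ^ (-k) ≤ ENNReal.ofReal (2 * C₀ / a) then
          ((2 : ℝ≥0∞) ^ (-k)) ^ (1 : ℝ) else 0) := by
    intro k
    by_cases h : ρ (cellCenter α k (gridIndex α k x)) < cellRadius d k
    swap
    · rw [if_neg h]; exact zero_le
    rw [if_pos h]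
    set c := cellCenter α k (gridIndex α k x) with hc
    have hcρ := hρ c
    have hr := cellRadius_pos hd k
    have hxc : ‖c - x‖ ≤ cellRadius d k := by
      rw [norm_sub_rev]
      exact norm_sub_cellCenter_le hd (show gridIndex α k x = gridIndex α k x from rfl)
    -- With the cell center as base point, this bounds the discount by `C₀ * ρ x / cellRadius d k`,
    -- which decays geometrically in `k`.
    have h1 := one_add_div_le_of_norm_sub_le hρ hC hN hlow (A := 1) hr le_rfl (by simp) hxc
    rw [Real.one_rpow, mul_one, hratio] at h1
    have hψ : 1 ≤ 1 + cellRadius d k / ρ c := by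
      have : 0 < cellRadius d k / ρ c := by positivity
      linarith
    -- A supercritical cell through `x` cannot be much smaller than `ρ x`, so the geometric series
    -- starts at scale `ρ x`. Of the upper exponent only `N / (N + 1) ≤ 1` is used.
    have h2 : ρ x ≤ 2 * C₀ * cellRadius d k := by
      have h3 : (1 + ‖c - x‖ / ρ c) ^ (N / (N + 1)) ≤ 1 + cellRadius d k / ρ c := by
        have h4 : 1 + ‖c - x‖ / ρ c ≤ 1 + cellRadius d k / ρ c := by gcongr
        have h5 : 1 ≤ 1 + ‖c - x‖ / ρ c := by
          have : 0 ≤ ‖c - x‖ / ρ c := by positivity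
          linarith
        refine le_trans (Real.rpow_le_rpow_of_exponent_le h5 (y := N / (N + 1)) (z := 1) ?_) ?_
        · rw [div_le_one (by linarith)]; linarith
        · rwa [Real.rpow_one]
      have h6 := (hup c x).trans (mul_le_mul_of_nonneg_left h3 (by positivity))
      have h7 : C₀ * ρ c * (1 + cellRadius d k / ρ c) = C₀ * (ρ c + cellRadius d k) := by
        field_simp
      rw [h7] at h6
      nlinarith
    have hz : (2 : ℝ≥0∞) ^ (-k) = ENNReal.ofReal ((2 : ℝ) ^ (-k)) := by
      rw [← ENNReal.rpow_intCast, ← Real.rpow_intCast, ← ENNReal.ofReal_rpow_of_pos two_pos,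
        ENNReal.ofReal_ofNat]
    have hcond : (2 : ℝ≥0∞) ^ (-k) ≤ ENNReal.ofReal (2 * C₀ / a) := by
      rw [hz]
      refine ENNReal.ofReal_le_ofReal ?_
      rw [le_div_iff₀ ha0]
      have h8 : (2 : ℝ) ^ (-k) * a = ρ x / cellRadius d k := by
        rw [← inv_div, hratio, inv_inv, mul_comm]
      rw [h8, div_le_iff₀ hr]; exact h2
    rw [if_pos hcond, ENNReal.rpow_one, hz, ← ENNReal.ofReal_mul (by positivity)]
    refine ENNReal.ofReal_le_ofReal ?_
    have hψ0 : 0 < 1 + cellRadius d k / ρ c := by linarith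
    rw [Real.rpow_neg hψ0.le, mul_assoc]
    have h9 : 0 < a * 2 ^ (-k) := by positivity
    rw [inv_le_comm₀ (by positivity) (by positivity), mul_inv]
    rw [inv_mul_le_iff₀ (by linarith)]
    exact h1
  refine (ENNReal.tsum_le_tsum hterm).trans ?_
  have hneg := (Equiv.neg ℤ).tsum_eq (fun k : ℤ =>
    if (2 : ℝ≥0∞) ^ k ≤ ENNReal.ofReal (2 * C₀ / a) then ((2 : ℝ≥0∞) ^ k) ^ (1 : ℝ) else 0)
  simp only [Equiv.neg_apply] at hneg
  rw [ENNReal.tsum_mul_left, hneg]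
  refine (mul_le_mul_right (hCs _) _).trans (le_of_eq ?_)
  rw [ENNReal.rpow_one, mul_left_comm, ← ENNReal.ofReal_mul (by positivity)]
  push_cast
  congr 2
  field_simp

/-! ### Consequences of the weight conditions -/

lemma IsWeight.exists_measurable {d : ℕ} {w : EuclideanSpace ℝ (Fin d) → ℝ≥0∞} (hw : IsWeight w) :
    ∃ w' : EuclideanSpace ℝ (Fin d) → ℝ≥0∞, Measurable w' ∧ (∀ x, w' x ≠ 0) ∧
      (∀ x, w' x ≠ ∞) ∧ w =ᵐ[volume] w' := by
  have hm : AEMeasurable w volume := hw.1.aestronglyMeasurable.aemeasurable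
  have hS : MeasurableSet {x | 0 < hm.mk w x ∧ hm.mk w x < ∞} :=
    (measurableSet_lt measurable_const hm.measurable_mk).inter
      (measurableSet_lt hm.measurable_mk measurable_const)
  classical
  refine ⟨fun x => if 0 < hm.mk w x ∧ hm.mk w x < ∞ then hm.mk w x else 1,
    Measurable.ite hS hm.measurable_mk measurable_const, fun x => ?_, fun x => ?_, ?_⟩
  · dsimp only; split_ifs with h
    · exact h.1.ne'
    · exact one_ne_zero
  · dsimp only; split_ifs with h
    · exact h.2.ne
    · exact ENNReal.one_ne_top
  · filter_upwards [hw.2, hm.ae_eq_mk] with x hx he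
    rw [he] at hx
    rw [if_pos hx, he]

lemma IsWeight.lintegral_cube_ne_top {d : ℕ} (hd : 0 < d)
    {w : EuclideanSpace ℝ (Fin d) → ℝ≥0∞} (hw : IsWeight w)
    (x : EuclideanSpace ℝ (Fin d)) {r : ℝ} (hr : 0 ≤ r) : ∫⁻ y in cube x r, w y ≠ ∞ := by
  have h1 : IntegrableOn w (Metric.closedBall x r) volume :=
    hw.1.integrableOn_isCompact (isCompact_closedBall x r)
  have h2 : cube x r ⊆ Metric.closedBall x r := fun y hy => by
    rw [mem_closedBall_iff_norm]; exact norm_sub_le_of_mem_cube hd hr hy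
  have h3 := (h1.mono_set h2).2
  rw [hasFiniteIntegral_iff_enorm] at h3
  simpa using h3.ne

/-- Averages over a cube are dominated by averages weighted by an `A_1` weight. -/
lemma exists_lintegral_mul_le_of_mem_A1 {d : ℕ} {ρ : EuclideanSpace ℝ (Fin d) → ℝ}
    {u : EuclideanSpace ℝ (Fin d) → ℝ≥0∞} (hu : u ∈ A1 ρ fun _ => 1) : ∃ θ : ℝ, 0 ≤ θ ∧ ∃ C : ℝ≥0,
    ∀ (x : EuclideanSpace ℝ (Fin d)) (r : ℝ), 0 < r → ∀ g : EuclideanSpace ℝ (Fin d) → ℝ≥0∞,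
      ((∫⁻ y in cube x r, u y) / volume (cube x r)) * ∫⁻ y in cube x r, g y ≤
        C * ENNReal.ofReal ((1 + r / ρ x) ^ θ) * ∫⁻ y in cube x r, g y * u y := by
  obtain ⟨θ, hθ, hw, C, hC⟩ := hu
  refine ⟨θ, hθ, C, fun x r hr g => ?_⟩
  have h1 := hC x r hr
  simp only [wAverage, mul_one, setLIntegral_one] at h1
  refine (mul_le_mul_left h1 _).trans ?_
  rw [mul_assoc]
  refine mul_le_mul_right ((lintegral_const_mul_le _ _).trans (lintegral_mono_ae ?_)) _
  filter_upwards [ae_essInf_le (f := u) (μ := volume.restrict (cube x r))] with y hy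
  rw [mul_comm]
  exact mul_le_mul_right hy _

/-- The `A_p` conditions, in a form where the exponents are normalised by `s = p' - 1`. -/
lemma exists_wAverage_rpow_mul_le_of_mem_AInfty {d : ℕ} {ρ : EuclideanSpace ℝ (Fin d) → ℝ}
    (hρ : ∀ x, 0 < ρ x) {u v : EuclideanSpace ℝ (Fin d) → ℝ≥0∞} (hu : IsWeight u)
    (hv : v ∈ AInfty ρ u) : ∃ s : ℝ, 0 < s ∧ ∃ θ : ℝ, 0 ≤ θ ∧ ∃ K : ℝ≥0,
    ∀ (x : EuclideanSpace ℝ (Fin d)) (r : ℝ), 0 < r →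
      wAverage u v (cube x r) ^ s * wAverage u (fun y => v y ^ (-s)) (cube x r) ≤
        K * ENNReal.ofReal ((1 + r / ρ x) ^ θ) := by
  rcases hv with ⟨θ, hθ, hw, C, hC⟩ | ⟨p, hp, θ, hθ, hw, C, hC⟩
  -- An `A_1` weight is treated as an `A_2` weight: the average of `v⁻¹` is at most the inverse of
  -- the essential infimum.
  · refine ⟨1, one_pos, θ, hθ, C, fun x r hr => ?_⟩
    set e := essInf v (volume.restrict (cube x r)) with he
    have hinv : wAverage u (fun y => v y ^ (-1 : ℝ)) (cube x r) ≤ e⁻¹ := by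
      have h1 : ∫⁻ y in cube x r, v y ^ (-1 : ℝ) * u y ≤ e⁻¹ * ∫⁻ y in cube x r, u y := by
        rw [← lintegral_const_mul'' _ hu.1.aestronglyMeasurable.aemeasurable.restrict]
        refine lintegral_mono_ae ?_
        filter_upwards [ae_essInf_le (f := v) (μ := volume.restrict (cube x r))] with y hy
        rw [ENNReal.rpow_neg_one]
        exact mul_le_mul_left (ENNReal.inv_le_inv.2 hy) _
      refine (ENNReal.div_le_div_right h1 _).trans ?_
      rw [mul_div_assoc]
      exact mul_le_of_le_one_right' ENNReal.div_self_le_one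
    rw [ENNReal.rpow_one]
    refine (mul_le_mul' (hC x r hr) hinv).trans ?_
    rw [mul_assoc]
    exact mul_le_of_le_one_right' (ENNReal.mul_inv_le_one _)
  · have hpq := Real.HolderConjugate.conjExponent hp
    set q := p.conjExponent with hq
    have hq1 : 1 < q := hpq.symm.lt
    have hqs : 1 / p * q = q - 1 := by
      have hp0 : p ≠ 0 := by linarith
      have := hpq.sub_one_mul_conj
      rw [hq, Real.conjExponent]
      have hp1 : p - 1 ≠ 0 := by linarith
      field_simp; ring
    -- Raising the `A_p` condition to the power `q = p'` turns the exponents `1 / p` and `1 / q`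
    -- into `q - 1` and `1`.
    refine ⟨q - 1, by linarith, θ * q, by positivity, C ^ q, fun x r hr => ?_⟩
    have hψ : 0 ≤ 1 + r / ρ x := by have := hρ x; positivity
    have h1 := ENNReal.rpow_le_rpow (hC x r hr) (by linarith : 0 ≤ q)
    rw [ENNReal.mul_rpow_of_nonneg _ _ (by linarith), ENNReal.mul_rpow_of_nonneg _ _ (by linarith),
      ← ENNReal.rpow_mul, ← ENNReal.rpow_mul, hqs, one_div_mul_cancel (by linarith),
      ENNReal.rpow_one, ENNReal.ofReal_rpow_of_nonneg (by positivity) (by linarith),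
      ← Real.rpow_mul hψ] at h1
    rw [ENNReal.coe_rpow_of_nonneg _ (by linarith), neg_sub]
    exact h1

/-! ### Passage to grid cells and the supercritical regime -/

/-- Averages over cubes, discounted by a sufficiently high power of the growth factor, are
dominated by discounted averages, weighted by an `A_1` weight, over grid cells. -/
lemma exists_discounted_average_le {d : ℕ} (hd : 0 < d) {ρ : EuclideanSpace ℝ (Fin d) → ℝ}
    (hρ : IsCriticalRadius ρ) {u : EuclideanSpace ℝ (Fin d) → ℝ≥0∞}
    (hu : u ∈ A1 ρ fun _ => 1) (τ : ℝ) (hτ : 0 ≤ τ) : ∃ σ : ℝ, 0 ≤ σ ∧ ∃ A : ℝ≥0,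
    ∀ (x₀ : EuclideanSpace ℝ (Fin d)) (r₀ : ℝ), 0 < r₀ → ∃ (α : Fin d → Bool) (k : ℤ)
      (n : Fin d → ℤ), cube x₀ r₀ ⊆ gridCell α k n ∧
      ∀ g : EuclideanSpace ℝ (Fin d) → ℝ≥0∞,
        ENNReal.ofReal ((1 + r₀ / ρ x₀) ^ (-σ)) *
            ((∫⁻ y in cube x₀ r₀, g y) / volume (cube x₀ r₀)) ≤
          A * ENNReal.ofReal ((1 + cellRadius d k / ρ (cellCenter α k n)) ^ (-τ)) *
            ((∫⁻ y in gridCell α k n, g y * u y) / ∫⁻ y in gridCell α k n, u y) := by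
  obtain ⟨hρ0, C₀, N, hC₀, hN, hρ⟩ := hρ
  have hw : IsWeight u := hu.choose_spec.2.1
  obtain ⟨θ, hθ, C, hC⟩ := exists_lintegral_mul_le_of_mem_A1 hu
  set B : ℝ := 1 + C₀ * 6 ^ (N + 1) with hB
  have hB0 : 0 < B := by positivity
  -- The growth factor of the cell is at most `B` times the `(N + 1)`-th power of that of the cube;
  -- `θ` is spent on the `A_1` condition and `τ` survives.
  refine ⟨(N + 1) * (τ + θ), by positivity, (B ^ (τ + θ)).toNNReal * 6 ^ d * C,
    fun x₀ r₀ hr₀ => ?_⟩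
  obtain ⟨α, k, n, hsub, hrad, hvol⟩ := exists_cube_subset_gridCell hd x₀ hr₀
  refine ⟨α, k, n, hsub, fun g => ?_⟩
  set c := cellCenter α k n with hc
  set R := cellRadius d k with hR
  have hR0 : 0 < R := cellRadius_pos hd k
  have hρx := hρ0 x₀
  have hρc := hρ0 c
  set S := 1 + r₀ / ρ x₀ with hS
  set ψ := 1 + R / ρ c with hψ
  have hS1 : 1 ≤ S := by have : 0 < r₀ / ρ x₀ := by positivity
                         linarith
  have hψ1 : 1 ≤ ψ := by have : 0 < R / ρ c := by positivity
                         linarith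
  have hae : gridCell α k n =ᵐ[volume] cube c R := gridCell_ae_eq_cube hd α k n
  have hx₀ : x₀ ∈ cube x₀ r₀ := fun i => by simp; positivity
  have hψS : ψ ≤ B * S ^ (N + 1) := by
    have h1 := one_add_div_le_of_norm_sub_le hρ0 hC₀ hN (fun x y => (hρ x y).1) (A := 6) hr₀
      (by norm_num) hrad (norm_sub_cellCenter_le hd (hsub hx₀))
    have h2 : 1 ≤ S ^ (N + 1) := Real.one_le_rpow hS1 (by linarith)
    rw [hψ, hB, add_mul, one_mul]
    exact add_le_add h2 h1
  have hpow : S ^ (-((N + 1) * (τ + θ))) ≤ B ^ (τ + θ) * ψ ^ (-(τ + θ)) := by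
    have h1 : ψ / B ≤ S ^ (N + 1) := by rw [div_le_iff₀ hB0]; linarith
    have h2 := Real.rpow_le_rpow_of_nonpos (by positivity : 0 < ψ / B) h1
      (by linarith : -(τ + θ) ≤ 0)
    rw [← Real.rpow_mul (by linarith), mul_neg] at h2
    refine h2.trans (le_of_eq ?_)
    rw [Real.div_rpow (by linarith) hB0.le, Real.rpow_neg hB0.le]
    field_simp
  have hcell0 : volume (gridCell α k n) ≠ 0 := by
    have hsd : 0 < √(d : ℝ) := by positivity
    rw [measure_congr hae, volume_cube]
    exact pow_ne_zero _ (by simpa using by positivity)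
  have hcellt : volume (gridCell α k n) ≠ ∞ := by
    rw [measure_congr hae, volume_cube]
    exact ENNReal.pow_ne_top ENNReal.ofReal_ne_top
  have hut : ∫⁻ y in gridCell α k n, u y ≠ ∞ := by
    rw [setLIntegral_congr hae]
    exact hw.lintegral_cube_ne_top hd c hR0.le
  have hu0 : ∫⁻ y in gridCell α k n, u y ≠ 0 := by
    intro h0
    rw [lintegral_eq_zero_iff' hw.1.aestronglyMeasurable.aemeasurable.restrict] at h0
    have h1 : ∀ᵐ y ∂(volume.restrict (gridCell α k n)), False := by
      filter_upwards [h0, ae_restrict_of_ae hw.2] with y hy hy'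
      simp [hy] at hy'
    rw [Filter.eventually_false_iff_eq_bot, ae_eq_bot, Measure.restrict_eq_zero] at h1
    exact hcell0 h1
  have hA1 : (∫⁻ y in gridCell α k n, g y) / volume (gridCell α k n) ≤
      C * ENNReal.ofReal (ψ ^ θ) *
        ((∫⁻ y in gridCell α k n, g y * u y) / ∫⁻ y in gridCell α k n, u y) := by
    have h1 := hC c R hR0 g
    rw [← measure_congr hae, ← setLIntegral_congr hae, ← setLIntegral_congr hae,
      ← setLIntegral_congr hae] at h1
    rw [← mul_div_assoc, ENNReal.le_div_iff_mul_le (Or.inl hu0) (Or.inl hut)]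
    refine le_trans (le_of_eq ?_) h1
    simp only [div_eq_mul_inv]; ring
  have hleb : (∫⁻ y in cube x₀ r₀, g y) / volume (cube x₀ r₀) ≤
      6 ^ d * ((∫⁻ y in gridCell α k n, g y) / volume (gridCell α k n)) := by
    rw [← mul_div_assoc, ENNReal.le_div_iff_mul_le (Or.inl hcell0) (Or.inl hcellt)]
    have h1 : (∫⁻ y in cube x₀ r₀, g y) ≤ ∫⁻ y in gridCell α k n, g y :=
      lintegral_mono_set hsub
    calc (∫⁻ y in cube x₀ r₀, g y) / volume (cube x₀ r₀) * volume (gridCell α k n)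
        ≤ (∫⁻ y in gridCell α k n, g y) / volume (cube x₀ r₀) *
            (6 ^ d * volume (cube x₀ r₀)) := by gcongr
      _ = 6 ^ d * (∫⁻ y in gridCell α k n, g y) *
            (volume (cube x₀ r₀) / volume (cube x₀ r₀)) := by
          simp only [div_eq_mul_inv]; ring
      _ ≤ _ := mul_le_of_le_one_right' ENNReal.div_self_le_one
  calc ENNReal.ofReal (S ^ (-((N + 1) * (τ + θ)))) *
        ((∫⁻ y in cube x₀ r₀, g y) / volume (cube x₀ r₀))
      ≤ ENNReal.ofReal (B ^ (τ + θ) * ψ ^ (-(τ + θ))) * (6 ^ d * (C * ENNReal.ofReal (ψ ^ θ) *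
        ((∫⁻ y in gridCell α k n, g y * u y) / ∫⁻ y in gridCell α k n, u y))) := by
        refine mul_le_mul' (ENNReal.ofReal_le_ofReal hpow)
          (hleb.trans (mul_le_mul_right hA1 _))
    _ = _ := by
        have e : ψ ^ (-τ) = ψ ^ (-(τ + θ)) * ψ ^ θ := by
          rw [← Real.rpow_add (by linarith)]; congr 1; ring
        rw [e, ENNReal.ofReal_mul (by positivity), ENNReal.ofReal_mul (by positivity)]
        push_cast
        rw [show ((B ^ (τ + θ)).toNNReal : ℝ≥0∞) = ENNReal.ofReal (B ^ (τ + θ)) from rfl]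
        ring

/-- On this set the density is below the threshold, so no condition on `v` is needed. The bound is
linear in `c`, which lets the discounts be summed. -/
lemma withDensity_inter_lt_le {X : Type*} [MeasurableSpace X] {μ : Measure X} {v : X → ℝ≥0∞}
    (hv : Measurable v) {Q : Set X} (hQ : MeasurableSet Q) (c : ℝ≥0∞) (hμ : μ Q ≠ 0)
    (hμ' : μ Q ≠ ∞) (a : ℝ≥0∞) :
    μ.withDensity v {x | x ∈ Q ∧ v x < c * (a / μ Q)} ≤ c * a := by
  have hm : MeasurableSet {x | x ∈ Q ∧ v x < c * (a / μ Q)} :=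
    hQ.inter (measurableSet_lt hv measurable_const)
  rw [withDensity_apply _ hm]
  calc ∫⁻ x in {x | x ∈ Q ∧ v x < c * (a / μ Q)}, v x ∂μ
      ≤ ∫⁻ _ in {x | x ∈ Q ∧ v x < c * (a / μ Q)}, c * (a / μ Q) ∂μ :=
        setLIntegral_mono' hm fun x hx => hx.2.le
    _ ≤ c * (a / μ Q) * μ Q := by
        rw [setLIntegral_const]
        exact mul_le_mul_right (measure_mono fun x hx => hx.1) _
    _ = c * a := by rw [mul_assoc, ENNReal.div_mul_cancel hμ hμ']

/-- The contribution of the cells of one grid that are larger than the critical radius. -/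
lemma withDensity_supercritical_le {d : ℕ} {ρ : EuclideanSpace ℝ (Fin d) → ℝ} {τ : ℝ} {C : ℝ≥0}
    {α : Fin d → Bool} (hC : ∀ x : EuclideanSpace ℝ (Fin d), ∑' k : ℤ,
      (if ρ (cellCenter α k (gridIndex α k x)) < cellRadius d k then
        ENNReal.ofReal ((1 + cellRadius d k / ρ (cellCenter α k (gridIndex α k x))) ^ (-τ))
        else 0) ≤ C)
    {μ : Measure (EuclideanSpace ℝ (Fin d))} (hμ0 : ∀ k n, μ (gridCell α k n) ≠ 0)
    (hμt : ∀ k n, μ (gridCell α k n) ≠ ∞) {v g : EuclideanSpace ℝ (Fin d) → ℝ≥0∞}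
    (hv : Measurable v) (hg : Measurable g) (a : ℝ≥0∞) :
    μ.withDensity v {x | ∃ k n, ρ (cellCenter α k n) < cellRadius d k ∧ x ∈ gridCell α k n ∧
        v x < a * ENNReal.ofReal ((1 + cellRadius d k / ρ (cellCenter α k n)) ^ (-τ)) *
          ((∫⁻ y in gridCell α k n, g y ∂μ) / μ (gridCell α k n))} ≤
      C * a * ∫⁻ y, g y ∂μ := by
  classical
  set w : ℤ → (Fin d → ℤ) → ℝ≥0∞ := fun k n =>
    if ρ (cellCenter α k n) < cellRadius d k then
      ENNReal.ofReal ((1 + cellRadius d k / ρ (cellCenter α k n)) ^ (-τ)) else 0 with hw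
  have hcover : {x | ∃ k n, ρ (cellCenter α k n) < cellRadius d k ∧ x ∈ gridCell α k n ∧
        v x < a * ENNReal.ofReal ((1 + cellRadius d k / ρ (cellCenter α k n)) ^ (-τ)) *
          ((∫⁻ y in gridCell α k n, g y ∂μ) / μ (gridCell α k n))} ⊆
      ⋃ k, ⋃ n, {x | x ∈ gridCell α k n ∧
        v x < a * w k n * ((∫⁻ y in gridCell α k n, g y ∂μ) / μ (gridCell α k n))} := by
    rintro x ⟨k, n, hk, hx, hlt⟩
    refine Set.mem_iUnion₂.2 ⟨k, n, hx, ?_⟩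
    simpa only [hw, if_pos hk] using hlt
  have hm : ∀ k n, MeasurableSet (gridCell α k n) := measurableSet_gridCell α
  have hterm : ∀ k n, Measurable fun x => (gridCell α k n).indicator (fun _ => w k n) x * g x :=
    fun k n => (measurable_const.indicator (hm k n)).mul hg
  calc _ ≤ ∑' k, ∑' n, a * w k n * ∫⁻ y in gridCell α k n, g y ∂μ := by
        refine (measure_mono hcover).trans ((measure_iUnion_le _).trans
          (ENNReal.tsum_le_tsum fun k => (measure_iUnion_le _).trans
            (ENNReal.tsum_le_tsum fun n => ?_)))
        exact withDensity_inter_lt_le hv (hm k n) _ (hμ0 k n) (hμt k n) _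
    _ = ∑' k, ∑' n, a * ∫⁻ y, (gridCell α k n).indicator (fun _ => w k n) y * g y ∂μ := by
        refine tsum_congr fun k => tsum_congr fun n => ?_
        rw [mul_assoc, ← lintegral_indicator (hm k n),
          ← lintegral_const_mul _ (hg.indicator (hm k n))]
        congr 1
        refine lintegral_congr fun y => ?_
        by_cases hy : y ∈ gridCell α k n <;> simp [hy]
    _ = a * ∫⁻ y, ∑' k, ∑' n, (gridCell α k n).indicator (fun _ => w k n) y * g y ∂μ := by
        simp_rw [ENNReal.tsum_mul_left]
        rw [lintegral_tsum fun k =>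
          (Measurable.tsum fun n => hterm k n).aemeasurable]
        congr 1
        refine tsum_congr fun k => ?_
        rw [lintegral_tsum fun n => (hterm k n).aemeasurable]
    _ ≤ a * ∫⁻ y, C * g y ∂μ := by
        refine mul_le_mul_right (lintegral_mono fun y => ?_) _
        simp_rw [ENNReal.tsum_mul_right]
        refine mul_le_mul_left (le_trans (ENNReal.tsum_le_tsum fun k => ?_) (hC y)) _
        -- Only one cell of each generation contains `y`.
        rw [tsum_eq_single (gridIndex α k y)]
        · exact Set.indicator_le_self' (fun _ _ => zero_le) y
        · intro n hn
          exact Set.indicator_of_notMem (fun h => hn (Eq.symm h)) _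
    _ = _ := by rw [lintegral_const_mul _ hg]; ring

end CriticalRadius

end

/-! ### Assembly of the two regimes -/

theorem mainTheorem1 (d : ℕ) (hd : 0 < d) (ρ : EuclideanSpace ℝ (Fin d) → ℝ)
    (hρ : CriticalRadius.IsCriticalRadius ρ)
    (u v : EuclideanSpace ℝ (Fin d) → ℝ≥0∞)
    (hu : u ∈ CriticalRadius.A1 ρ (fun _ => 1))
    (hv : v ∈ CriticalRadius.AInfty ρ u) :
    ∃ σ : ℝ, 0 ≤ σ ∧ ∃ C : ℝ≥0, ∀ (f : EuclideanSpace ℝ (Fin d) → ℝ),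
      AEStronglyMeasurable f volume → (∃ B : ℝ, ∀ x, |f x| ≤ B) → HasCompactSupport f →
      ∀ t : ℝ, 0 < t →
        volume.withDensity (fun x => u x * v x)
            {x | ENNReal.ofReal t <
              CriticalRadius.maximal ρ σ (fun y => ‖f y‖ₑ * v y) x / v x} ≤
          C / ENNReal.ofReal t * ∫⁻ x, ‖f x‖ₑ * u x * v x := by
  open CriticalRadius in
  have hwu : IsWeight u := hu.choose_spec.2.1
  have hwv : IsWeight v := by
    rcases hv with ⟨_, _, h, _⟩ | ⟨_, _, _, _, h, _⟩ <;> exact h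
  obtain ⟨s, hs, θ, hθ, K, hK⟩ := exists_wAverage_rpow_mul_le_of_mem_AInfty hρ.1 hwu hv
  have hρ' := hρ
  obtain ⟨hρ0, C₀, N, hC₀, hN, hCN⟩ := hρ'
  -- The discount kept is exactly the one needed in `exists_tsum_supercritical_le`.
  obtain ⟨σ, hσ, A, hA⟩ := exists_discounted_average_le hd hρ hu (N + 1) (by linarith)
  obtain ⟨C₁, hC₁⟩ := exists_withDensity_lt_average_le_of_countable hs
    (K * ((2 : ℝ) ^ θ).toNNReal)
  obtain ⟨C₂, hC₂⟩ := exists_tsum_supercritical_le hd hρ0 hC₀ hN (fun x y => (hCN x y).1)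
    (fun x y => (hCN x y).2)
  obtain ⟨u', hu'm, hu'0, hu't, huu'⟩ := hwu.exists_measurable
  obtain ⟨v', hv'm, hv'0, hv't, hvv'⟩ := hwv.exists_measurable
  set μ : Measure (EuclideanSpace ℝ (Fin d)) := volume.withDensity u' with hμ
  have hdens : volume.withDensity (fun x => u x * v x) = μ.withDensity v' := by
    rw [hμ, ← withDensity_mul _ hu'm hv'm]
    exact withDensity_congr_ae (huu'.mul hvv')
  have hac : μ.withDensity v' ≪ volume :=
    (withDensity_absolutelyContinuous _ _).trans (withDensity_absolutelyContinuous _ _)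
  have hint : ∀ Q, MeasurableSet Q → ∀ g : EuclideanSpace ℝ (Fin d) → ℝ≥0∞, Measurable g →
      ∫⁻ y in Q, g y ∂μ = ∫⁻ y in Q, g y * u y := fun Q hQ g hg => by
    rw [hμ, setLIntegral_withDensity_eq_setLIntegral_mul _ hu'm hg hQ]
    refine lintegral_congr_ae ?_
    filter_upwards [ae_restrict_of_ae huu'] with y hy
    rw [Pi.mul_apply, hy, mul_comm]
  have hμQ : ∀ Q, MeasurableSet Q → μ Q = ∫⁻ y in Q, u y := fun Q hQ => by
    rw [← setLIntegral_one, hint Q hQ _ measurable_const]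
    simp
  have hm : ∀ α k n, MeasurableSet (gridCell (d := d) α k n) := measurableSet_gridCell
  have hae := gridCell_ae_eq_cube hd
  have hμt : ∀ (α : Fin d → Bool) k n, μ (gridCell α k n) ≠ ∞ := fun α k n => by
    rw [hμQ _ (hm α k n), setLIntegral_congr (hae α k n)]
    exact hwu.lintegral_cube_ne_top hd _ (cellRadius_pos hd k).le
  have hμ0 : ∀ (α : Fin d → Bool) k n, μ (gridCell α k n) ≠ 0 := fun α k n h0 => by
    have hsd : 0 < √(d : ℝ) := by positivity
    have hr := cellRadius_pos hd k
    have h1 : volume (gridCell α k n) = 0 :=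
      withDensity_absolutelyContinuous' hu'm.aemeasurable (ae_of_all _ hu'0) h0
    rw [measure_congr (hae α k n), volume_cube] at h1
    exact pow_ne_zero d (by simpa using by positivity) h1
  have hAp : ∀ (α : Fin d → Bool) k n, cellRadius d k ≤ ρ (cellCenter α k n) →
      ((∫⁻ y in gridCell α k n, v' y ∂μ) / μ (gridCell α k n)) ^ s *
        ((∫⁻ y in gridCell α k n, v' y ^ (-s) ∂μ) / μ (gridCell α k n)) ≤
      (K * ((2 : ℝ) ^ θ).toNNReal : ℝ≥0) := fun α k n hk => by
    have h1 := hK (cellCenter α k n) (cellRadius d k) (cellRadius_pos hd k)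
    have e1 : ∫⁻ y in gridCell α k n, v' y ∂μ = ∫⁻ y in gridCell α k n, v y * u y := by
      rw [hint _ (hm α k n) _ hv'm]
      refine lintegral_congr_ae ?_
      filter_upwards [ae_restrict_of_ae hvv'] with y hy
      rw [hy]
    have e2 : ∫⁻ y in gridCell α k n, v' y ^ (-s) ∂μ =
        ∫⁻ y in gridCell α k n, v y ^ (-s) * u y := by
      rw [hint _ (hm α k n) _ (hv'm.pow_const _)]
      refine lintegral_congr_ae ?_
      filter_upwards [ae_restrict_of_ae hvv'] with y hy
      rw [hy]
    rw [e1, e2, hμQ _ (hm α k n)]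
    simp only [wAverage, ← setLIntegral_congr (hae α k n)] at h1
    refine h1.trans ?_
    push_cast
    refine mul_le_mul_right (ENNReal.ofReal_le_ofReal ?_) _
    have hc := hρ0 (cellCenter α k n)
    have hr := cellRadius_pos hd k
    refine Real.rpow_le_rpow (by positivity) ?_ hθ
    have : cellRadius d k / ρ (cellCenter α k n) ≤ 1 := (div_le_one hc).2 hk
    linarith
  -- There are `2 ^ d` grids, each contributing `C₁` from subcritical and `C₂` from supercritical
  -- cells.
  refine ⟨σ, hσ, 2 ^ d * ((C₁ + C₂) * A), fun f hf _ _ t ht => ?_⟩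
  set T := ENNReal.ofReal t with hT
  have hT0 : T ≠ 0 := by simpa [hT] using ht
  have hTt : T ≠ ∞ := ENNReal.ofReal_ne_top
  obtain ⟨g, hgm, hg⟩ : ∃ g : EuclideanSpace ℝ (Fin d) → ℝ≥0∞, Measurable g ∧
      (fun y => ‖f y‖ₑ * v y) =ᵐ[volume] g :=
    (hf.enorm.mul hwv.1.aestronglyMeasurable.aemeasurable)
  have hgint : ∫⁻ y, g y ∂μ = ∫⁻ x, ‖f x‖ₑ * u x * v x := by
    rw [← setLIntegral_univ, hint _ MeasurableSet.univ _ hgm, setLIntegral_univ]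
    refine lintegral_congr_ae ?_
    filter_upwards [hg] with y hy
    rw [← hy]; ring
  set a : ℝ≥0∞ := A / T with ha
  have hat : a ≠ ∞ := ENNReal.div_ne_top ENNReal.coe_ne_top hT0
  let small : (Fin d → Bool) → Set (EuclideanSpace ℝ (Fin d)) := fun α =>
    {x | ∃ Q ∈ {Q | ∃ k n, cellRadius d k ≤ ρ (cellCenter α k n) ∧ Q = gridCell α k n},
      x ∈ Q ∧ v' x < (∫⁻ y in Q, a * g y ∂μ) / μ Q}
  let large : (Fin d → Bool) → Set (EuclideanSpace ℝ (Fin d)) := fun α =>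
    {x | ∃ k n, ρ (cellCenter α k n) < cellRadius d k ∧ x ∈ gridCell α k n ∧
      v' x < a * ENNReal.ofReal ((1 + cellRadius d k / ρ (cellCenter α k n)) ^ (-(N + 1))) *
        ((∫⁻ y in gridCell α k n, g y ∂μ) / μ (gridCell α k n))}
  have hsmall : ∀ α, μ.withDensity v' (small α) ≤ C₁ * a * ∫⁻ y, g y ∂μ := fun α => by
    rw [mul_assoc, ← lintegral_const_mul _ hgm]
    refine hC₁ μ v' (fun y => a * g y) hv'm hv'0 hv't
      {Q | ∃ k n, cellRadius d k ≤ ρ (cellCenter α k n) ∧ Q = gridCell α k n} ?_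
      (isLaminar_gridCell α ?_) ?_ ?_ ?_ ?_
    · refine (Set.countable_range fun kn : ℤ × (Fin d → ℤ) => gridCell α kn.1 kn.2).mono ?_
      rintro _ ⟨k, n, -, rfl⟩
      exact ⟨(k, n), rfl⟩
    · rintro _ ⟨k, n, -, rfl⟩; exact ⟨k, n, rfl⟩
    · rintro _ ⟨k, n, -, rfl⟩; exact hm α k n
    · rintro _ ⟨k, n, -, rfl⟩; exact hμ0 α k n
    · rintro _ ⟨k, n, -, rfl⟩; exact hμt α k n
    · rintro _ ⟨k, n, hk, rfl⟩; exact hAp α k n hk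
  have hlarge : ∀ α, μ.withDensity v' (large α) ≤ C₂ * a * ∫⁻ y, g y ∂μ := fun α =>
    withDensity_supercritical_le (hC₂ α) (hμ0 α) (hμt α) hv'm hgm a
  -- The exceptional set where `v` differs from its representative is null for `uv dx`. On small
  -- cells the discount is at most 1 and is dropped.
  have hcover : {x | T < maximal ρ σ (fun y => ‖f y‖ₑ * v y) x / v x} ⊆
      {x | ¬ v x = v' x} ∪ ⋃ α, (small α ∪ large α) := by
    intro x hx
    by_cases hvx : v x = v' x
    swap
    · exact Or.inl hvx
    right
    have h1 : T * v' x < maximal ρ σ (fun y => ‖f y‖ₑ * v y) x := by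
      rw [Set.mem_ofPred_eq, hvx] at hx
      rwa [ENNReal.lt_div_iff_mul_lt (Or.inl (hv'0 x)) (Or.inl (hv't x))] at hx
    simp only [maximal, lt_iSup_iff] at h1
    obtain ⟨x₀, r₀, hr₀, hx₀, h1⟩ := h1
    simp only [enorm_eq_self] at h1
    rw [lintegral_congr_ae (ae_restrict_of_ae hg)] at h1
    obtain ⟨α, k, n, hsub, h2⟩ := hA x₀ r₀ hr₀
    have h3 := h1.trans_le (h2 g)
    rw [← hint _ (hm α k n) _ hgm, ← hμQ _ (hm α k n), mul_comm T] at h3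
    have h4 : v' x < a * ENNReal.ofReal ((1 + cellRadius d k / ρ (cellCenter α k n)) ^ (-(N + 1))) *
        ((∫⁻ y in gridCell α k n, g y ∂μ) / μ (gridCell α k n)) := by
      have h5 := (ENNReal.lt_div_iff_mul_lt (Or.inl hT0) (Or.inl hTt)).2 h3
      refine h5.trans_le (le_of_eq ?_)
      simp only [ha, div_eq_mul_inv]; ring
    refine Set.mem_iUnion.2 ⟨α, ?_⟩
    rcases lt_or_ge (ρ (cellCenter α k n)) (cellRadius d k) with hk | hk
    · exact Or.inr ⟨k, n, hk, hsub hx₀, h4⟩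
    · refine Or.inl ⟨gridCell α k n, ⟨k, n, hk, rfl⟩, hsub hx₀, h4.trans_le ?_⟩
      rw [lintegral_const_mul _ hgm, mul_div_assoc]
      refine mul_le_mul_left (mul_le_of_le_one_right' ?_) _
      have hc := hρ0 (cellCenter α k n)
      have hr := cellRadius_pos hd k
      rw [← ENNReal.ofReal_one]
      refine ENNReal.ofReal_le_ofReal (Real.rpow_le_one_of_one_le_of_nonpos ?_ (by linarith))
      have : 0 < cellRadius d k / ρ (cellCenter α k n) := by positivity
      linarith
  rw [hdens, ← hgint]
  calc _ ≤ μ.withDensity v' {x | ¬ v x = v' x} + ∑ α, μ.withDensity v' (small α ∪ large α) := by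
        refine (measure_mono hcover).trans ((measure_union_le _ _).trans ?_)
        exact add_le_add le_rfl (measure_iUnion_fintype_le _ _)
    _ ≤ 0 + ∑ _α : Fin d → Bool, (C₁ * a * ∫⁻ y, g y ∂μ + C₂ * a * ∫⁻ y, g y ∂μ) := by
        refine add_le_add (le_of_eq (hac (ae_iff.1 hvv'))) (Finset.sum_le_sum fun α _ => ?_)
        exact (measure_union_le _ _).trans (add_le_add (hsmall α) (hlarge α))
    _ = _ := by
        rw [zero_add, Finset.sum_const, nsmul_eq_mul, Finset.card_univ, Fintype.card_fun,
          Fintype.card_bool, Fintype.card_fin, ha]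
        push_cast
        simp only [div_eq_mul_inv]; ring
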